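/- Let $k$ be a field of characteristic $0$ and let $\mathbf H$ be a hypergraph on a finite vertex set $V$ with $n=|V|$, i.e. a collection of nonempty subsets of $V$ (the hyperedges) that contains all singletons. Let $P_{\mathbf H}=\sum_{e\in\mathbf H}\mathrm{conv}\{e_i : i\in e\}\subset\mathbb R^V$ (Minkowski sum; $e_i$ the standard basis vectors) be its hypergraphic polytope, and let $f(P_{\mathbf H},q)=\sum_{i} f_i\,q^i$, where $f_i$ is the number of nonempty faces of $P_{\mathbf H}$ of dimension $i$, the polytope itself included. Let $\mathcal{HG}$ be the $k(q)$-vector space with basis the isomorphism classes $[\mathbf H]$ of finite hypergraphs, graded by the number of vertices, with coproduct $\Delta([\mathbf H])=\sum_{S\subseteq V}[\mathbf H|_S]\otimes[\mathbf H/S]$, where $\mathbf H|_S=\{e\in\mathbf H: e\subseteq S\}$ is a hypergraph on $S$ and $\mathbf H/S=\{e\setminus S: e\in\mathbf H,\ e\not\subseteq S\}$ is a hypergraph on $V\setminus S$. For $t\in k(q)$ let $\zeta_t([\mathbf H])=t^{\,n-c(\mathbf H)}$, where $c(\mathbf H)$ is the number of connected components of $\mathbf H$, and let $$\Psi_t([\mathbf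 H])=\sum_{\alpha\models n}(\zeta_t)_\alpha([\mathbf H])\,M_\alpha ,$$ where $M_\alpha$ is the monomial quasisymmetric function and, for $\alpha=(\alpha_1,\dots,\alpha_r)$, $(\zeta_t)_\alpha$ is the composition of the iterated coproduct $\mathcal{HG}\to\mathcal{HG}^{\otimes r}$, the projection onto $\mathcal{HG}_{\alpha_1}\otimes\cdots\otimes\mathcal{HG}_{\alpha_r}$ and $\zeta_t^{\otimes r}$ (for $r=0$: the counit). For a quasisymmetric function $F$ in $x_1,x_2,\dots$ let $\mathbf{ps}(F)(m)$ be the polynomial in $m$ whose value at each natural number $m$ is obtained from $F$ by setting $x_1=\dots=x_m=1$ and $x_i=0$ for $i>m$. Then $$f(P_{\mathbf H},q)=(-1)^n\,\mathbf{ps}\bigl(\Psi_{-q}([\mathbf H])\bigr)(-1).$$ -/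

import Mathlib

open scoped Pointwise TensorProduct

/-- A finite hypergraph without ghost vertices: a finite vertex set (labelled by natural numbers)
and a collection of nonempty subsets of it, the hyperedges, which contains all singletons. -/
@[ext]
structure FinHypergraph where
  verts : Finset ℕ
  edges : Finset (Finset ℕ)
  subset_verts : ∀ e ∈ edges, e ⊆ verts
  edge_nonempty : ∀ e ∈ edges, e.Nonempty
  singleton_mem : ∀ v ∈ verts, {v} ∈ edges

namespace FinHypergraph

/-- The restriction `H|_S = {e ∈ H : e ⊆ S}`, on the vertex set `S` (for `S ⊆ verts`). -/
def restrict (H : FinHypergraph) (S : Finset ℕ) : FinHypergraph where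
  verts := H.verts ∩ S
  edges := H.edges.filter (· ⊆ S)
  subset_verts := by
    intro e he
    rw [Finset.mem_filter] at he
    exact Finset.subset_inter (H.subset_verts e he.1) he.2
  edge_nonempty := by
    intro e he
    rw [Finset.mem_filter] at he
    exact H.edge_nonempty e he.1
  singleton_mem := by
    intro v hv
    rw [Finset.mem_inter] at hv
    rw [Finset.mem_filter, Finset.singleton_subset_iff]
    exact ⟨H.singleton_mem v hv.1, hv.2⟩

/-- The contraction `H/S = {e \ S : e ∈ H}`, on the vertex set `verts \ S`; hyperedges being
nonempty, the empty set (which arises from `e ⊆ S`) is discarded. -/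
def contract (H : FinHypergraph) (S : Finset ℕ) : FinHypergraph where
  verts := H.verts \ S
  edges := (H.edges.image (· \ S)).erase ∅
  subset_verts := by
    intro e he
    obtain ⟨-, h⟩ := Finset.mem_erase.1 he
    obtain ⟨e', he', rfl⟩ := Finset.mem_image.1 h
    exact Finset.sdiff_subset_sdiff (H.subset_verts e' he') le_rfl
  edge_nonempty := by
    intro e he
    exact Finset.nonempty_iff_ne_empty.2 (Finset.mem_erase.1 he).1
  singleton_mem := by
    intro v hv
    obtain ⟨h1, h2⟩ := Finset.mem_sdiff.1 hv
    refine Finset.mem_erase.2 ⟨Finset.singleton_ne_empty v, Finset.mem_image.2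
      ⟨{v}, H.singleton_mem v h1, ?_⟩⟩
    exact Finset.sdiff_eq_self_of_disjoint (Finset.disjoint_singleton_left.2 h2)

/-- The number `c(H)` of connected components: the number of classes of the equivalence relation
on the vertices that is generated by lying in a common hyperedge. -/
noncomputable def numComponents (H : FinHypergraph) : ℕ :=
  Nat.card (Quot fun i j : H.verts => ∃ e ∈ H.edges, (i : ℕ) ∈ e ∧ (j : ℕ) ∈ e)

/-- The rank `rk(H) = n - c(H)` of a hypergraph on `n` vertices
(every component has a vertex, so the subtraction is not truncated). -/
noncomputable def rank (H : FinHypergraph) : ℕ := H.verts.card - H.numComponents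

/-- `f` restricts to an isomorphism from `H` to `H'`: a bijection of the vertex sets which
sends the hyperedges of `H` to the hyperedges of `H'`. -/
structure IsIso (f : ℕ → ℕ) (H H' : FinHypergraph) : Prop where
  injOn : Set.InjOn f H.verts
  image_verts : H.verts.image f = H'.verts
  image_edges : H.edges.image (Finset.image f) = H'.edges

theorem IsIso.symm {f : ℕ → ℕ} {H H' : FinHypergraph} (h : IsIso f H H') :
    IsIso (Function.invFunOn f (H.verts : Set ℕ)) H' H := by
  have inv : ∀ x ∈ H.verts, Function.invFunOn f (H.verts : Set ℕ) (f x) = x :=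
    fun x hx => h.injOn.leftInvOn_invFunOn hx
  have im : ∀ s : Finset ℕ, s ⊆ H.verts →
      (s.image f).image (Function.invFunOn f (H.verts : Set ℕ)) = s := by
    intro s hs
    rw [Finset.image_image]
    conv_rhs => rw [← Finset.image_id (s := s)]
    exact Finset.image_congr fun x hx => inv x (hs hx)
  refine ⟨?_, ?_, ?_⟩
  · rw [← h.image_verts]
    intro x hx y hy hxy
    obtain ⟨a, ha, rfl⟩ := Finset.mem_image.1 (Finset.mem_coe.1 hx)
    obtain ⟨b, hb, rfl⟩ := Finset.mem_image.1 (Finset.mem_coe.1 hy)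
    rw [inv a ha, inv b hb] at hxy
    rw [hxy]
  · rw [← h.image_verts]
    exact im _ le_rfl
  · rw [← h.image_edges, Finset.image_image]
    conv_rhs => rw [← Finset.image_id (s := H.edges)]
    exact Finset.image_congr fun e he => im e (H.subset_verts e he)

theorem IsIso.comp {f g : ℕ → ℕ} {H H' H'' : FinHypergraph} (h : IsIso f H H')
    (h' : IsIso g H' H'') : IsIso (g ∘ f) H H'' := by
  refine ⟨?_, ?_, ?_⟩
  · refine h'.injOn.comp h.injOn fun x hx => ?_
    rw [← h.image_verts]
    exact Finset.mem_coe.2 (Finset.mem_image_of_mem f hx)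
  · rw [← Finset.image_image, h.image_verts, h'.image_verts]
  · rw [← h'.image_edges, ← h.image_edges, Finset.image_image]
    exact Finset.image_congr fun e _ => (Finset.image_image).symm

theorem isIso_id (H : FinHypergraph) : IsIso id H H := by
  refine ⟨Function.injective_id.injOn, Finset.image_id, ?_⟩
  conv_rhs => rw [← Finset.image_id (s := H.edges)]
  exact Finset.image_congr fun e _ => Finset.image_id

/-- Isomorphism of hypergraphs. -/
instance isoSetoid : Setoid FinHypergraph where
  r H H' := ∃ f, IsIso f H H'
  iseqv :=
    ⟨fun H => ⟨id, isIso_id H⟩, fun ⟨_, h⟩ => ⟨_, h.symm⟩, fun ⟨_, h⟩ ⟨_, h'⟩ => ⟨_, h.comp h'⟩⟩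

theorem IsIso.card_verts {f : ℕ → ℕ} {H H' : FinHypergraph} (h : IsIso f H H') :
    H.verts.card = H'.verts.card := by
  rw [← h.image_verts, Finset.card_image_of_injOn h.injOn]

theorem IsIso.numComponents_le {f : ℕ → ℕ} {H H' : FinHypergraph} (h : IsIso f H H') :
    H'.numComponents ≤ H.numComponents := by
  have hf : ∀ i : H.verts, f i ∈ H'.verts := fun i => by
    rw [← h.image_verts]
    exact Finset.mem_image_of_mem f i.2
  let F : (Quot fun i j : H.verts => ∃ e ∈ H.edges, (i : ℕ) ∈ e ∧ (j : ℕ) ∈ e) →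
      (Quot fun i j : H'.verts => ∃ e ∈ H'.edges, (i : ℕ) ∈ e ∧ (j : ℕ) ∈ e) :=
    Quot.map (fun i => ⟨f i, hf i⟩) (by
      rintro i j ⟨e, he, hi, hj⟩
      refine ⟨e.image f, ?_, Finset.mem_image_of_mem f hi, Finset.mem_image_of_mem f hj⟩
      rw [← h.image_edges]
      exact Finset.mem_image_of_mem _ he)
  refine Nat.card_le_card_of_surjective F ?_
  rintro ⟨⟨j, hj⟩⟩
  rw [← h.image_verts] at hj
  obtain ⟨i, hi, rfl⟩ := Finset.mem_image.1 hj
  exact ⟨Quot.mk _ ⟨i, hi⟩, rfl⟩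

theorem IsIso.rank_eq {f : ℕ → ℕ} {H H' : FinHypergraph} (h : IsIso f H H') :
    H.rank = H'.rank := by
  unfold rank
  rw [h.card_verts, le_antisymm h.symm.numComponents_le h.numComponents_le]

theorem IsIso.image_subset_iff {f : ℕ → ℕ} {H H' : FinHypergraph} (h : IsIso f H H')
    {s t : Finset ℕ} (hs : s ⊆ H.verts) (ht : t ⊆ H.verts) :
    s.image f ⊆ t.image f ↔ s ⊆ t := by
  refine ⟨fun hst x hx => ?_, fun hst => Finset.image_subset_image hst⟩
  obtain ⟨y, hy, hyx⟩ := Finset.mem_image.1 (hst (Finset.mem_image_of_mem f hx))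
  rwa [← h.injOn (ht hy) (hs hx) hyx]

theorem IsIso.image_sdiff {f : ℕ → ℕ} {H H' : FinHypergraph} (h : IsIso f H H')
    {s t : Finset ℕ} (hs : s ⊆ H.verts) (ht : t ⊆ H.verts) :
    (s \ t).image f = s.image f \ t.image f := by
  ext y
  simp only [Finset.mem_image, Finset.mem_sdiff]
  constructor
  · rintro ⟨x, ⟨hx, hxt⟩, rfl⟩
    refine ⟨⟨x, hx, rfl⟩, ?_⟩
    rintro ⟨z, hz, hzx⟩
    exact hxt (h.injOn (ht hz) (hs hx) hzx ▸ hz)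
  · rintro ⟨⟨x, hx, rfl⟩, hn⟩
    exact ⟨x, ⟨hx, fun hxt => hn ⟨x, hxt, rfl⟩⟩, rfl⟩

theorem IsIso.restrict {f : ℕ → ℕ} {H H' : FinHypergraph} (h : IsIso f H H')
    {S : Finset ℕ} (hS : S ⊆ H.verts) : IsIso f (H.restrict S) (H'.restrict (S.image f)) := by
  refine ⟨h.injOn.mono ?_, ?_, ?_⟩
  · exact Finset.coe_subset.2 Finset.inter_subset_left
  · change (H.verts ∩ S).image f = H'.verts ∩ S.image f
    rw [← h.image_verts, Finset.inter_eq_right.2 hS,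
      Finset.inter_eq_right.2 (Finset.image_subset_image hS)]
  · change (H.edges.filter (· ⊆ S)).image (Finset.image f) = H'.edges.filter (· ⊆ S.image f)
    ext e
    simp only [← h.image_edges, Finset.mem_image, Finset.mem_filter]
    constructor
    · rintro ⟨a, ⟨ha, haS⟩, rfl⟩
      exact ⟨⟨a, ha, rfl⟩, Finset.image_subset_image haS⟩
    · rintro ⟨⟨a, ha, rfl⟩, haS⟩
      exact ⟨a, ⟨ha, (h.image_subset_iff (H.subset_verts a ha) hS).1 haS⟩, rfl⟩

theorem IsIso.contract {f : ℕ → ℕ} {H H' : FinHypergraph} (h : IsIso f H H')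
    {S : Finset ℕ} (hS : S ⊆ H.verts) : IsIso f (H.contract S) (H'.contract (S.image f)) := by
  refine ⟨h.injOn.mono ?_, ?_, ?_⟩
  · exact Finset.coe_subset.2 Finset.sdiff_subset
  · change (H.verts \ S).image f = H'.verts \ S.image f
    rw [← h.image_verts, h.image_sdiff le_rfl hS]
  · change ((H.edges.image (· \ S)).erase ∅).image (Finset.image f) =
      (H'.edges.image (· \ S.image f)).erase ∅
    ext e
    simp only [← h.image_edges, Finset.mem_image, Finset.mem_erase]
    constructor
    · rintro ⟨a, ⟨hne, b, hb, rfl⟩, rfl⟩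
      exact ⟨fun h0 => hne (Finset.image_eq_empty.1 h0),
        b.image f, ⟨b, hb, rfl⟩, (h.image_sdiff (H.subset_verts b hb) hS).symm⟩
    · rintro ⟨hne, a, ⟨b, hb, rfl⟩, rfl⟩
      rw [← h.image_sdiff (H.subset_verts b hb) hS] at hne ⊢
      exact ⟨b \ S, ⟨fun h0 => hne (by rw [h0, Finset.image_empty]), b, hb, rfl⟩, rfl⟩

/-- The simplex `Δ_e = conv {e_i : i ∈ e}` in `ℝ^V`, where `V` is the vertex set. -/
def simplex (H : FinHypergraph) (e : Finset ℕ) : Set (H.verts → ℝ) :=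
  convexHull ℝ ((fun i : H.verts => (Pi.single i 1 : H.verts → ℝ)) '' {i | (i : ℕ) ∈ e})

/-- The hypergraphic polytope `P_H`: the Minkowski sum of the simplices `Δ_e`, `e ∈ H`. -/
def polytope (H : FinHypergraph) : Set (H.verts → ℝ) := ∑ e ∈ H.edges, H.simplex e

end FinHypergraph

/-- The number of `i`-dimensional (nonempty) faces of a polytope `Q`, the polytope itself included.
A face is the set of points at which some linear functional is maximal on `Q`; its dimension is
that of its affine span. -/
noncomputable def faceNumber {E : Type*} [AddCommGroup E] [Module ℝ E] [TopologicalSpace E]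
    (Q : Set E) (i : ℕ) : ℕ :=
  {G : Set E | G.Nonempty ∧ IsExposed ℝ Q G ∧ Module.finrank ℝ (vectorSpan ℝ G) = i}.ncard

/-- The `f`-polynomial `f(Q, q) = ∑ᵢ fᵢ qⁱ`, where `fᵢ` is the number of `i`-dimensional faces. -/
noncomputable def fPolynomial {E : Type*} [AddCommGroup E] [Module ℝ E] [TopologicalSpace E]
    (Q : Set E) : Polynomial ℤ :=
  ∑ i ∈ Finset.range (Module.finrank ℝ E + 1), Polynomial.monomial i (faceNumber Q i : ℤ)

/-- Isomorphism classes of finite hypergraphs. -/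
abbrev HypergraphClass : Type := Quotient FinHypergraph.isoSetoid

namespace HypergraphClass

/-- The number of vertices. -/
def size : HypergraphClass → ℕ :=
  Quotient.lift (fun H => H.verts.card) fun _ _ ⟨_, h⟩ => h.card_verts

/-- The rank `rk(H) = n - c(H)`. -/
noncomputable def rank : HypergraphClass → ℕ :=
  Quotient.lift FinHypergraph.rank fun _ _ ⟨_, h⟩ => h.rank_eq

end HypergraphClass

/-- The vector space of hypergraphs over `K`, with basis the isomorphism classes `[H]`. -/
abbrev HG (K : Type*) [Field K] : Type _ := HypergraphClass →₀ K

namespace HG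

/-- The basis element `[H]`. -/
noncomputable def of (K : Type*) [Field K] (H : FinHypergraph) : HG K :=
  Finsupp.single ⟦H⟧ 1

/-- `Δ([H]) = ∑_{S ⊆ V} [H|_S] ⊗ [H/S]`, on isomorphism classes. -/
noncomputable def comulClass (K : Type*) [Field K] : HypergraphClass → HG K ⊗[K] HG K :=
  Quotient.lift
    (fun H : FinHypergraph =>
      ∑ S ∈ H.verts.powerset, (of K (H.restrict S) ⊗ₜ[K] of K (H.contract S)))
    (by
      rintro H H' ⟨f, h⟩
      refine Finset.sum_bij (fun S _ => S.image f) ?_ ?_ ?_ ?_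
      · intro S hS
        rw [Finset.mem_powerset] at hS ⊢
        rw [← h.image_verts]
        exact Finset.image_subset_image hS
      · intro S hS T hT hST
        rw [Finset.mem_powerset] at hS hT
        exact subset_antisymm ((h.image_subset_iff hS hT).1 hST.le)
          ((h.image_subset_iff hT hS).1 hST.ge)
      · intro T hT
        rw [Finset.mem_powerset, ← h.image_verts, Finset.subset_image_iff] at hT
        obtain ⟨S, hS, rfl⟩ := hT
        exact ⟨S, Finset.mem_powerset.2 (Finset.coe_subset.1 hS), rfl⟩
      · intro S hS
        rw [Finset.mem_powerset] at hS
        have h1 : (⟦H.restrict S⟧ : HypergraphClass) = ⟦H'.restrict (S.image f)⟧ :=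
          Quotient.sound ⟨f, h.restrict hS⟩
        have h2 : (⟦H.contract S⟧ : HypergraphClass) = ⟦H'.contract (S.image f)⟧ :=
          Quotient.sound ⟨f, h.contract hS⟩
        unfold of
        rw [h1, h2])

/-- The coproduct of the Hopf algebra of hypergraphs. -/
noncomputable def comul (K : Type*) [Field K] : HG K →ₗ[K] HG K ⊗[K] HG K :=
  Finsupp.linearCombination K (comulClass K)

/-- The projection onto the homogeneous component spanned by the hypergraphs on `a` vertices. -/
noncomputable def proj (K : Type*) [Field K] (a : ℕ) : HG K →ₗ[K] HG K :=
  Finsupp.linearCombination K fun c => if c.size = a then Finsupp.single c 1 else 0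

/-- The counit: the projection onto the component of degree `0`, identified with `K`. -/
noncomputable def counit (K : Type*) [Field K] : HG K →ₗ[K] K :=
  Finsupp.linearCombination K fun c => if c.size = 0 then 1 else 0

/-- The character `ζ_t([H]) = t ^ rk(H)`. -/
noncomputable def zeta {K : Type*} [Field K] (t : K) : HG K →ₗ[K] K :=
  Finsupp.linearCombination K fun c => t ^ c.rank

/-- For `α = (a₁, …, a_k)`, the functional `ζ_α`: the iterated coproduct into `k` factors, followed
by the projections onto the components of degrees `a₁, …, a_k` and by `ζ` on each factor. -/
noncomputable def zetaComp {K : Type*} [Field K] (ζ : HG K →ₗ[K] K) : List ℕ → (HG K →ₗ[K] K)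
  | [] => counit K
  | a :: α =>
      LinearMap.mul' K K ∘ₗ TensorProduct.map (ζ ∘ₗ proj K a) (zetaComp ζ α) ∘ₗ comul K

end HG

/-- The monomial quasisymmetric function
`M_α = ∑_{i₁ < ⋯ < i_k} x_{i₁} ^ α₁ ⋯ x_{i_k} ^ α_k` in the variables `x₀, x₁, …`: the coefficient
of a monomial is `1` if its nonzero exponents, read by increasing index, form the list `α`,
and `0` otherwise. -/
noncomputable def monomialQSym (K : Type*) [Field K] {n : ℕ} (α : Composition n) :
    MvPowerSeries ℕ K :=
  fun d => if (d.support.sort (· ≤ ·)).map d = α.blocks then 1 else 0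

/-- The space of quasisymmetric functions, spanned by the monomial quasisymmetric functions. -/
noncomputable def QSym (K : Type*) [Field K] : Submodule K (MvPowerSeries ℕ K) :=
  Submodule.span K (Set.range fun α : Σ n, Composition n => monomialQSym K α.2)

namespace QSym

/-- `M_α` as an element of `QSym`. -/
noncomputable def M (K : Type*) [Field K] {n : ℕ} (α : Composition n) : QSym K :=
  ⟨monomialQSym K α, Submodule.subset_span ⟨⟨n, α⟩, rfl⟩⟩

/-- The value of `F` at `x_i = 1` for the first `m` variables and `x_i = 0` for all others: the sum
of the coefficients of the monomials in the first `m` variables. -/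
noncomputable def evalOnes {K : Type*} [Field K] (F : QSym K) (m : ℕ) : K :=
  ∑ᶠ d ∈ {d : ℕ →₀ ℕ | ∀ i ∈ d.support, i < m}, MvPowerSeries.coeff d (F : MvPowerSeries ℕ K)

open Classical in
/-- The principal specialization `ps(F)`: the polynomial whose value at each natural number `m` is
the value of `F` at `x_i = 1` for the first `m` variables and `x_i = 0` for all others. -/
noncomputable def ps {K : Type*} [Field K] (F : QSym K) : Polynomial K :=
  if h : ∃ p : Polynomial K, ∀ m : ℕ, p.eval (m : K) = evalOnes F m then h.choose else 0

end QSym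

/-- The universal morphism `Ψ_t : (HG, ζ_t) → (QSym, ζ_Q)` of combinatorial Hopf algebras:
`Ψ_t([H]) = ∑_{α ⊨ n} (ζ_t)_α([H]) M_α` for a hypergraph `H` on `n` vertices. -/
noncomputable def Psi {K : Type*} [Field K] (t : K) : HG K →ₗ[K] QSym K :=
  Finsupp.linearCombination K fun c =>
    ∑ α : Composition c.size,
      HG.zetaComp (HG.zeta t) α.blocks (Finsupp.single c 1) • QSym.M K α

/-!
Since `M_α` specializes to the binomial coefficient `m.choose ℓ(α)`, its value at `-1` is
`(-1) ^ ℓ(α)`. Unfolding the iterated coproduct, `ps (Ψ_t [H]) (-1)` becomes the sum over the ordered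
set partitions `L` of the vertices of `(-1) ^ ℓ(L) * t ^ r(L)`, where `r(L)` is the sum of the ranks
of the successive minors of `H` along `L` (`eval_neg_one_ps_Psi_of`).

An ordered set partition is a cone of the braid arrangement: a linear functional on `ℝ^V` up to the
ordering of its coefficients. On each simplex `Δ_e` it is maximal on `Δ_u`, where `u ⊆ e` is the set
of elements of `e` in the highest block, and the face of the Minkowski sum which it selects is the
sum of these faces. The sets `u` can be recovered from the face, because a functional is maximal at
a point of a Minkowski sum only if it is maximal at every summand (`face_level_eq_iff`). Every
nonempty face arises in this way (`nonempty_isExposed_polytope_iff`). The hypergraph formed by the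
sets `u` is the disjoint union of the minors of `H` along `L`, so `r(L)` is its rank
(`minorRank_eq_rank_faceHypergraph`), which in turn is the dimension of the face
(`finrank_vectorSpan_face`).

It remains to sum `(-1) ^ ℓ(L)` over all `L` that select a given face of dimension `d`. They are the
ordered set partitions satisfying certain equalities, whose classes are the `n - d` components of the
hypergraph of the face, and strict inequalities, which are satisfiable. The sum is therefore
`(-1) ^ (n - d)` (`sum_isCompatible_neg_one_pow`): removing the first block, which is any nonempty
union of minimal classes, gives an induction resting on the vanishing of the alternating sum over the
subsets of a nonempty finite set. For `t = -q` the face contributes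
`(-1) ^ n * (-q) ^ d * (-1) ^ (n - d) = q ^ d`.
-/

/-! ### Ordered set partitions -/

/-- The ordered set partitions of `V`: lists of pairwise disjoint nonempty sets with union `V`,
generated by choosing the first block and then an ordered set partition of its complement. -/
def setCompositions (V : Finset ℕ) : Finset (List (Finset ℕ)) :=
  if V = ∅ then {[]} else
    (V.powerset.erase ∅).attach.biUnion fun S =>
      (setCompositions (V \ S.1)).image (List.cons S.1)
termination_by V.card
decreasing_by
  have hS := Finset.mem_erase.1 S.2
  refine Finset.card_lt_card (Finset.sdiff_ssubset (Finset.mem_powerset.1 hS.2) ?_)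
  exact Finset.nonempty_iff_ne_empty.2 hS.1

theorem setCompositions_empty : setCompositions ∅ = {[]} := by
  rw [setCompositions]; simp

theorem setCompositions_of_nonempty {V : Finset ℕ} (hV : V.Nonempty) :
    setCompositions V = (V.powerset.erase ∅).biUnion fun S =>
      (setCompositions (V \ S)).image (List.cons S) := by
  rw [setCompositions, if_neg hV.ne_empty]
  ext L
  simp only [Finset.mem_biUnion, Finset.mem_attach, true_and, Subtype.exists, exists_prop]

theorem mem_setCompositions_cons {V S : Finset ℕ} {L : List (Finset ℕ)} :
    S :: L ∈ setCompositions V ↔ S.Nonempty ∧ S ⊆ V ∧ L ∈ setCompositions (V \ S) := by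
  rcases V.eq_empty_or_nonempty with rfl | hV
  · rw [setCompositions_empty]
    simp only [Finset.mem_singleton, reduceCtorEq, Finset.subset_empty, false_iff, not_and]
    rintro hS rfl
    exact absurd hS Finset.not_nonempty_empty
  · rw [setCompositions_of_nonempty hV]
    simp only [Finset.mem_biUnion, Finset.mem_erase, Finset.mem_powerset, Finset.mem_image,
      List.cons.injEq, Finset.nonempty_iff_ne_empty]
    constructor
    · rintro ⟨T, ⟨h1, h2⟩, M, hM, rfl, rfl⟩
      exact ⟨h1, h2, hM⟩
    · rintro ⟨h1, h2, hM⟩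
      exact ⟨S, ⟨h1, h2⟩, L, hM, rfl, rfl⟩

theorem nil_mem_setCompositions {V : Finset ℕ} : [] ∈ setCompositions V ↔ V = ∅ := by
  rcases V.eq_empty_or_nonempty with rfl | hV
  · simp [setCompositions_empty]
  · simp [setCompositions_of_nonempty hV, hV.ne_empty]

/-- Summation over ordered set partitions, one block at a time. -/
theorem sum_setCompositions {A : Type*} [AddCommMonoid A] {V : Finset ℕ} (hV : V.Nonempty)
    (f : List (Finset ℕ) → A) :
    ∑ L ∈ setCompositions V, f L =
      ∑ S ∈ V.powerset.erase ∅, ∑ L ∈ setCompositions (V \ S), f (S :: L) := by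
  rw [setCompositions_of_nonempty hV, Finset.sum_biUnion]
  · refine Finset.sum_congr rfl fun S _ => Finset.sum_image fun L _ L' _ h => ?_
    exact (List.cons.inj h).2
  · intro S _ T _ hST
    refine Finset.disjoint_left.2 fun L hL hL' => hST ?_
    obtain ⟨M, _, rfl⟩ := Finset.mem_image.1 hL
    obtain ⟨M', _, h⟩ := Finset.mem_image.1 hL'
    exact (List.cons.inj h).1.symm

theorem card_sdiff_lt_of_mem {V S : Finset ℕ} (hS : S ∈ V.powerset.erase ∅) :
    (V \ S).card < V.card := by
  obtain ⟨h1, h2⟩ := Finset.mem_erase.1 hS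
  exact Finset.card_lt_card (Finset.sdiff_ssubset (Finset.mem_powerset.1 h2)
    (Finset.nonempty_iff_ne_empty.2 h1))

/-- The index of the first block of `L` that contains `i` (the length of `L` if there is none). -/
def level : List (Finset ℕ) → ℕ → ℕ
  | [], _ => 0
  | S :: L, i => if i ∈ S then 0 else level L i + 1

theorem sum_card_of_mem_setCompositions {V : Finset ℕ} {L : List (Finset ℕ)}
    (hL : L ∈ setCompositions V) : (L.map Finset.card).sum = V.card := by
  induction L generalizing V with
  | nil => rw [nil_mem_setCompositions.1 hL]; rfl
  | cons S L ih =>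
    obtain ⟨-, h2, h3⟩ := mem_setCompositions_cons.1 hL
    rw [List.map_cons, List.sum_cons, ih h3, Finset.card_sdiff_of_subset h2]
    exact Nat.add_sub_cancel' (Finset.card_le_card h2)

theorem nonempty_of_mem_setCompositions {V : Finset ℕ} {L : List (Finset ℕ)}
    (hL : L ∈ setCompositions V) : ∀ S ∈ L, S.Nonempty := by
  induction L generalizing V with
  | nil => simp
  | cons S L ih =>
    obtain ⟨h1, -, h3⟩ := mem_setCompositions_cons.1 hL
    intro T hT
    rcases List.mem_cons.1 hT with rfl | hT
    · exact h1
    · exact ih h3 T hT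

/-- Every real function on `V` orders `V` in the same way as some ordered set partition: its level
sets, by increasing value. -/
theorem exists_mem_setCompositions_level_le_iff (V : Finset ℕ) (w : ℕ → ℝ) :
    ∃ L ∈ setCompositions V, ∀ i ∈ V, ∀ j ∈ V, level L i ≤ level L j ↔ w i ≤ w j := by
  induction h : V.card using Nat.strong_induction_on generalizing V with
  | _ n ih =>
  subst h
  rcases V.eq_empty_or_nonempty with rfl | hV
  · exact ⟨[], by simp [setCompositions_empty], by simp⟩
  obtain ⟨a, ha, hmin⟩ := V.exists_min_image w hV
  let S := V.filter fun i => w i = w a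
  have haS : a ∈ S := Finset.mem_filter.2 ⟨ha, rfl⟩
  have hSV : S ⊆ V := Finset.filter_subset _ _
  have hS : S ∈ V.powerset.erase ∅ := Finset.mem_erase.2
    ⟨Finset.ne_empty_of_mem haS, Finset.mem_powerset.2 hSV⟩
  obtain ⟨L, hL, hw⟩ := ih _ (card_sdiff_lt_of_mem hS) (V \ S) rfl
  refine ⟨S :: L, mem_setCompositions_cons.2 ⟨⟨a, haS⟩, hSV, hL⟩, fun i hi j hj => ?_⟩
  have key : ∀ {i}, i ∈ V → i ∉ S → w a < w i := fun {i} hi hn =>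
    lt_of_le_of_ne (hmin i hi) fun h => hn (Finset.mem_filter.2 ⟨hi, h.symm⟩)
  by_cases hiS : i ∈ S
  · have : w i = w a := (Finset.mem_filter.1 hiS).2
    simp [level, hiS, this, hmin j hj]
  · by_cases hjS : j ∈ S
    · have : w j = w a := (Finset.mem_filter.1 hjS).2
      simp [level, hiS, hjS, this, key hi hiS]
    · simpa [level, hiS, hjS] using
        hw i (Finset.mem_sdiff.2 ⟨hi, hiS⟩) j (Finset.mem_sdiff.2 ⟨hj, hjS⟩)

/-- `w` is constant on the fibres of `π` and strictly increasing along `R`, as far as elements of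
`V` are concerned. -/
def IsCompatible {X : Type*} (π : ℕ → X) (R : ℕ → ℕ → Prop) (V : Finset ℕ) (w : ℕ → ℕ) : Prop :=
  ∀ i ∈ V, ∀ j ∈ V, (π i = π j → w i = w j) ∧ (R i j → w i < w j)

/-- `S` can be the first block of a compatible ordered set partition of `V`: it is a union of
fibres of `π`, all of them minimal for `R`. -/
def IsInitial {X : Type*} (π : ℕ → X) (R : ℕ → ℕ → Prop) (V S : Finset ℕ) : Prop :=
  ∀ i ∈ V, ∀ j ∈ S, (π i = π j → i ∈ S) ∧ ¬ R i j

theorem isCompatible_level_cons {X : Type*} {π : ℕ → X} {R : ℕ → ℕ → Prop} {V S : Finset ℕ}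
    (hS : S ⊆ V) (L : List (Finset ℕ)) :
    IsCompatible π R V (level (S :: L)) ↔
      IsInitial π R V S ∧ IsCompatible π R (V \ S) (level L) := by
  constructor
  · intro h
    refine ⟨fun i hi j hj => ?_, fun i hi j hj => ?_⟩
    · have := h i hi j (hS hj)
      simp only [level, hj, if_true, Nat.not_lt_zero, imp_false] at this
      refine ⟨fun hπ => ?_, this.2⟩
      by_contra hn
      simpa [hn] using this.1 hπ
    · rw [Finset.mem_sdiff] at hi hj
      simpa [level, hi.2, hj.2] using h i hi.1 j hj.1
  · rintro ⟨h1, h2⟩ i hi j hj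
    by_cases hiS : i ∈ S
    · by_cases hjS : j ∈ S
      · exact ⟨fun _ => by simp [level, hiS, hjS], fun hR => absurd hR (h1 i hi j hjS).2⟩
      · exact ⟨fun hπ => absurd ((h1 j hj i hiS).1 hπ.symm) hjS,
          fun _ => by simp [level, hiS, hjS]⟩
    · by_cases hjS : j ∈ S
      · exact ⟨fun hπ => absurd ((h1 i hi j hjS).1 hπ) hiS,
          fun hR => absurd hR (h1 i hi j hjS).2⟩
      · simpa [level, hiS, hjS] using
          h2 i (Finset.mem_sdiff.2 ⟨hi, hiS⟩) j (Finset.mem_sdiff.2 ⟨hj, hjS⟩)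

open Classical in
/-- The initial sets are the unions of minimal fibres, and there is a minimal fibre, so that their
signed number vanishes. -/
theorem sum_isInitial_neg_one_pow {X : Type*} {π : ℕ → X} {R : ℕ → ℕ → Prop} {V : Finset ℕ}
    (hV : V.Nonempty) {w : ℕ → ℕ} (hw : IsCompatible π R V w) :
    ∑ S ∈ V.powerset with IsInitial π R V S, (-1 : ℤ) ^ (S.image π).card = 0 := by
  obtain ⟨a, ha, hmin⟩ := V.exists_min_image w hV
  let M : Finset X := (V.filter fun i => ∀ i' ∈ V, ∀ j ∈ V, π j = π i → ¬ R i' j).image π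
  have hM : M.Nonempty := by
    refine ⟨π a, Finset.mem_image_of_mem π (Finset.mem_filter.2 ⟨ha, fun i hi j hj hπ hR => ?_⟩)⟩
    have h1 := (hw i hi j hj).2 hR
    rw [(hw j hj a ha).1 hπ] at h1
    exact (hmin i hi).not_gt h1
  rw [← Finset.sum_powerset_neg_one_pow_card_of_nonempty hM]
  refine Finset.sum_nbij' (fun S => S.image π) (fun T => V.filter fun i => π i ∈ T) ?_ ?_ ?_ ?_ ?_
  · intro S hS
    obtain ⟨hSV, hS⟩ := Finset.mem_filter.1 hS
    rw [Finset.mem_powerset] at hSV ⊢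
    refine Finset.image_subset_image fun i hi => Finset.mem_filter.2 ⟨hSV hi, ?_⟩
    exact fun i' hi' j hj hπ => (hS i' hi' j ((hS j hj i hi).1 hπ)).2
  · intro T hT
    rw [Finset.mem_powerset] at hT
    refine Finset.mem_filter.2 ⟨Finset.mem_powerset.2 (Finset.filter_subset _ _), ?_⟩
    intro i hi j hj
    obtain ⟨hjV, hjT⟩ := Finset.mem_filter.1 hj
    refine ⟨fun hπ => Finset.mem_filter.2 ⟨hi, hπ ▸ hjT⟩, ?_⟩
    obtain ⟨b, hb, hbj⟩ := Finset.mem_image.1 (hT hjT)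
    exact (Finset.mem_filter.1 hb).2 i hi j hjV hbj.symm
  · intro S hS
    obtain ⟨hSV, hS⟩ := Finset.mem_filter.1 hS
    rw [Finset.mem_powerset] at hSV
    ext i
    rw [Finset.mem_filter, Finset.mem_image]
    constructor
    · rintro ⟨hi, j, hj, hπ⟩
      exact (hS i hi j hj).1 hπ.symm
    · exact fun hi => ⟨hSV hi, i, hi, rfl⟩
  · intro T hT
    rw [Finset.mem_powerset] at hT
    ext x
    simp only [Finset.mem_image, Finset.mem_filter]
    constructor
    · rintro ⟨i, ⟨-, hi⟩, rfl⟩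
      exact hi
    · intro hx
      obtain ⟨b, hb, rfl⟩ := Finset.mem_image.1 (hT hx)
      exact ⟨b, ⟨(Finset.mem_filter.1 hb).1, hx⟩, rfl⟩
  · exact fun S _ => rfl

open Classical in
/-- The signed count of the ordered set partitions in the relative interior of a normal cone; it is
the value at `-1` of a strict order polynomial. If the constraints are satisfiable at all, then
the result depends on the number of fibres of `π` only. -/
theorem sum_isCompatible_neg_one_pow {X : Type*} {π : ℕ → X} {R : ℕ → ℕ → Prop} {V : Finset ℕ}
    {w : ℕ → ℕ} (hw : IsCompatible π R V w) :
    ∑ L ∈ setCompositions V with IsCompatible π R V (level L), (-1 : ℤ) ^ L.length =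
      (-1) ^ (V.image π).card := by
  induction h : V.card using Nat.strong_induction_on generalizing V with
  | _ n ih =>
  subst h
  rcases V.eq_empty_or_nonempty with rfl | hV
  · rw [setCompositions_empty, Finset.sum_filter, Finset.sum_singleton, if_pos]
    · rfl
    · intro i hi
      exact absurd hi (Finset.notMem_empty i)
  have step : ∀ S ∈ V.powerset.erase ∅,
      (∑ L ∈ setCompositions (V \ S), if IsCompatible π R V (level (S :: L)) then
        (-1 : ℤ) ^ (S :: L).length else 0) =
      if IsInitial π R V S then -(-1) ^ (V.image π).card * (-1) ^ (S.image π).card else 0 := by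
    intro S hS
    have hSV : S ⊆ V := Finset.mem_powerset.1 (Finset.mem_erase.1 hS).2
    simp only [isCompatible_level_cons hSV]
    split_ifs with hi
    · simp only [hi, true_and, ← Finset.sum_filter, List.length_cons, pow_succ,
        ← Finset.sum_mul]
      have hw' : IsCompatible π R (V \ S) w := fun i hi j hj =>
        hw i (Finset.sdiff_subset hi) j (Finset.sdiff_subset hj)
      rw [ih _ (card_sdiff_lt_of_mem hS) hw' rfl]
      have hd : Disjoint ((V \ S).image π) (S.image π) := by
        refine Finset.disjoint_left.2 fun x hx hx' => ?_
        obtain ⟨i, hi', rfl⟩ := Finset.mem_image.1 hx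
        obtain ⟨j, hj, hπ⟩ := Finset.mem_image.1 hx'
        rw [Finset.mem_sdiff] at hi'
        exact hi'.2 ((hi i hi'.1 j hj).1 hπ.symm)
      have hc : (V.image π).card = ((V \ S).image π).card + (S.image π).card := by
        rw [← Finset.card_union_of_disjoint hd, ← Finset.image_union,
          Finset.sdiff_union_of_subset hSV]
      rw [hc, pow_add]
      have hsq : ((-1 : ℤ) ^ (S.image π).card) * (-1) ^ (S.image π).card = 1 := by
        rw [← mul_pow]; simp
      linear_combination (-1 : ℤ) ^ ((V \ S).image π).card * hsq
    · simp [hi]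
  have h0 := sum_isInitial_neg_one_pow hV hw
  rw [Finset.sum_filter, ← Finset.sum_erase_add _ _ (Finset.empty_mem_powerset V), if_pos] at h0
  · rw [Finset.sum_filter, sum_setCompositions hV, Finset.sum_congr rfl step, ← Finset.sum_filter,
      ← Finset.mul_sum, Finset.sum_filter]
    simp only [Finset.image_empty, Finset.card_empty, pow_zero] at h0
    rw [eq_neg_of_add_eq_zero_left h0]
    ring
  · intro i _ j hj
    exact absurd hj (Finset.notMem_empty j)

/-! ### Principal specialization at `-1` -/

/-- The monomials of a monomial quasisymmetric function with all variables among the first `m`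
correspond to their supports. -/
theorem ncard_monomials_eq_choose {l : List ℕ} (hl : ∀ a ∈ l, 0 < a) (m : ℕ) :
    {d : ℕ →₀ ℕ | (∀ i ∈ d.support, i < m) ∧ (d.support.sort (· ≤ ·)).map d = l}.Finite ∧
    {d : ℕ →₀ ℕ | (∀ i ∈ d.support, i < m) ∧ (d.support.sort (· ≤ ·)).map d = l}.ncard =
      m.choose l.length := by
  set A := {d : ℕ →₀ ℕ | (∀ i ∈ d.support, i < m) ∧ (d.support.sort (· ≤ ·)).map d = l}
  have hbij : Set.BijOn (fun d : ℕ →₀ ℕ => d.support) A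
      ((Finset.range m).powersetCard l.length : Finset (Finset ℕ)) := by
    refine ⟨?_, ?_, ?_⟩
    · rintro d ⟨h1, h2⟩
      refine Finset.mem_coe.2 (Finset.mem_powersetCard.2 ⟨fun i hi => Finset.mem_range.2 (h1 i hi),
        ?_⟩)
      rw [← h2, List.length_map, Finset.length_sort]
    · rintro d ⟨-, h2⟩ d' ⟨-, h2'⟩ h
      have h : d.support = d'.support := h
      rw [← h, ← h2] at h2'
      have h3 := List.map_inj_left.1 h2'
      ext i
      by_cases hi : i ∈ d.support
      · exact (h3 i ((Finset.mem_sort _).2 hi)).symm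
      · have hi' : i ∉ d'.support := h ▸ hi
        rw [Finsupp.notMem_support_iff.1 hi, Finsupp.notMem_support_iff.1 hi']
    · intro s hs
      obtain ⟨hs1, hs2⟩ := Finset.mem_powersetCard.1 (Finset.mem_coe.1 hs)
      let g : ℕ → ℕ := fun i => if i ∈ s then l.getD ((s.sort (· ≤ ·)).idxOf i) 0 else 0
      let d : ℕ →₀ ℕ := Finsupp.onFinset s g fun i hi => by
        by_contra hn
        exact hi (if_neg hn)
      have hlen : (s.sort (· ≤ ·)).length = l.length := by rw [Finset.length_sort, hs2]
      have hd : d.support = s := by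
        ext i
        rw [Finsupp.mem_support_iff]
        change g i ≠ 0 ↔ _
        by_cases hi : i ∈ s
        · have : (s.sort (· ≤ ·)).idxOf i < l.length := by
            rw [← hlen]
            exact List.idxOf_lt_length_of_mem ((Finset.mem_sort _).2 hi)
          simp only [g, hi, if_true, List.getD_eq_getElem _ _ this, iff_true]
          exact (hl _ (List.getElem_mem this)).ne'
        · simp [g, hi]
      refine ⟨d, ⟨fun i hi => ?_, ?_⟩, hd⟩
      · rw [hd] at hi
        exact Finset.mem_range.1 (hs1 hi)
      · rw [hd]
        refine List.ext_getElem (by rw [List.length_map, hlen]) fun i h1 h2 => ?_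
        rw [List.length_map] at h1
        rw [List.getElem_map]
        change g _ = _
        have hm : (s.sort (· ≤ ·))[i] ∈ s := (Finset.mem_sort (· ≤ ·)).1 (List.getElem_mem h1)
        simp only [g, hm, if_true, (Finset.sort_nodup s (· ≤ ·)).idxOf_getElem i h1,
          List.getD_eq_getElem _ _ h2]
  refine ⟨hbij.finite_iff_finite.2 (Finset.finite_toSet _), ?_⟩
  rw [← hbij.injOn.ncard_image, hbij.image_eq, Set.ncard_coe_finset, Finset.card_powersetCard,
    Finset.card_range]

theorem evalOnes_sum_smul_M {K : Type*} [Field K] {n : ℕ} (c : Composition n → K) (m : ℕ) :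
    QSym.evalOnes (∑ α, c α • QSym.M K α) m = ∑ α, c α * (m.choose α.length : K) := by
  classical
  let D : Set (ℕ →₀ ℕ) := {d | ∀ i ∈ d.support, i < m}
  have hfin := fun α : Composition n =>
    ncard_monomials_eq_choose (l := α.blocks) (fun a ha => α.blocks_pos ha) m
  let T : Composition n → Finset (ℕ →₀ ℕ) := fun α => (hfin α).1.toFinset
  have hT : ∀ α d, d ∈ T α ↔ d ∈ D ∧ (d.support.sort (· ≤ ·)).map d = α.blocks := fun α d =>
    (hfin α).1.mem_toFinset
  let U : Finset (ℕ →₀ ℕ) := Finset.univ.biUnion T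
  have hcoeff : ∀ d : ℕ →₀ ℕ, MvPowerSeries.coeff d
      ((∑ α, c α • QSym.M K α : QSym K) : MvPowerSeries ℕ K) =
      ∑ α : Composition n, if (d.support.sort (· ≤ ·)).map d = α.blocks then c α else 0 := by
    intro d
    rw [Submodule.coe_sum, map_sum]
    refine Finset.sum_congr rfl fun α _ => ?_
    rw [Submodule.coe_smul, map_smul, smul_eq_mul]
    change c α * (if _ then _ else _) = _
    rw [mul_ite, mul_one, mul_zero]
  unfold QSym.evalOnes
  simp only [hcoeff]
  rw [finsum_mem_eq_sum_of_inter_support_eq (t := U), Finset.sum_comm]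
  · refine Finset.sum_congr rfl fun α _ => ?_
    rw [← Finset.sum_filter, Finset.sum_const, nsmul_eq_mul, mul_comm]
    congr 2
    rw [Composition.length, ← (hfin α).2, Set.ncard_eq_toFinset_card _ (hfin α).1]
    congr 1
    ext d
    rw [Finset.mem_filter, Finset.mem_biUnion]
    constructor
    · rintro ⟨⟨β, -, hβ⟩, h⟩
      exact (hT α d).2 ⟨((hT β d).1 hβ).1, h⟩
    · exact fun h => ⟨⟨α, Finset.mem_univ _, h⟩, ((hT α d).1 h).2⟩
  · ext d
    refine and_congr_left fun hd => ?_
    rw [Function.mem_support] at hd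
    obtain ⟨α, -, hα⟩ := Finset.exists_ne_zero_of_sum_ne_zero hd
    have hα : (d.support.sort (· ≤ ·)).map d = α.blocks := by
      by_contra hn
      exact hα (if_neg hn)
    rw [Finset.mem_coe, Finset.mem_biUnion]
    exact ⟨fun h => ⟨α, Finset.mem_univ _, (hT α d).2 ⟨h, hα⟩⟩,
      fun ⟨β, _, hβ⟩ => ((hT β d).1 hβ).1⟩

theorem ps_eq_of_eval_eq {K : Type*} [Field K] [CharZero K] {F : QSym K} {p : Polynomial K}
    (hp : ∀ m : ℕ, p.eval (m : K) = QSym.evalOnes F m) : QSym.ps F = p := by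
  have h : ∃ p : Polynomial K, ∀ m : ℕ, p.eval (m : K) = QSym.evalOnes F m := ⟨p, hp⟩
  rw [QSym.ps, dif_pos h]
  refine Polynomial.eq_of_infinite_eval_eq _ _ ((Set.infinite_range_of_injective
    (Nat.cast_injective (R := K))).mono ?_)
  rintro _ ⟨m, rfl⟩
  exact (h.choose_spec m).trans (hp m).symm

/-- `M_α` specializes to the binomial coefficient polynomial of degree `ℓ(α)`, whose value at `-1`
is `(-1) ^ ℓ(α)`. -/
theorem eval_neg_one_ps_sum_smul_M {K : Type*} [Field K] [CharZero K] {n : ℕ}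
    (c : Composition n → K) :
    (QSym.ps (∑ α, c α • QSym.M K α)).eval (-1) = ∑ α, c α * (-1) ^ α.length := by
  have hf : ∀ k : ℕ, (k.factorial : K) ≠ 0 := fun k => Nat.cast_ne_zero.2 k.factorial_ne_zero
  rw [ps_eq_of_eval_eq (p := ∑ α, Polynomial.C (c α * (α.length.factorial : K)⁻¹) *
    descPochhammer K α.length)]
  · rw [Polynomial.eval_finsetSum]
    refine Finset.sum_congr rfl fun α _ => ?_
    rw [Polynomial.eval_mul, Polynomial.eval_C, descPochhammer_eval_eq_prod_range]
    have : ∏ j ∈ Finset.range α.length, (-1 - (j : K)) =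
        (-1) ^ α.length * (α.length.factorial : K) := by
      rw [← Finset.prod_range_add_one_eq_factorial, Nat.cast_prod]
      conv_rhs => rw [← Finset.card_range α.length, ← Finset.prod_const, Finset.card_range,
        ← Finset.prod_mul_distrib]
      refine Finset.prod_congr rfl fun j _ => ?_
      push_cast
      ring
    rw [this]
    field_simp [hf α.length]
  · intro m
    rw [evalOnes_sum_smul_M, Polynomial.eval_finsetSum]
    refine Finset.sum_congr rfl fun α _ => ?_
    rw [Polynomial.eval_mul, Polynomial.eval_C, descPochhammer_eval_eq_descFactorial,
      Nat.descFactorial_eq_factorial_mul_choose]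
    push_cast
    field_simp [hf α.length]

/-! ### Iterated coproducts -/

/-- The total rank of the successive minors of `H` along an ordered set partition. -/
noncomputable def minorRank : FinHypergraph → List (Finset ℕ) → ℕ
  | _, [] => 0
  | H, S :: L => (H.restrict S).rank + minorRank (H.contract S) L

theorem comul_of {K : Type*} [Field K] (H : FinHypergraph) :
    HG.comul K (HG.of K H) =
      ∑ S ∈ H.verts.powerset, HG.of K (H.restrict S) ⊗ₜ[K] HG.of K (H.contract S) := by
  rw [HG.comul, HG.of, Finsupp.linearCombination_single, one_smul]
  rfl

theorem zeta_proj_of {K : Type*} [Field K] (t : K) (a : ℕ) (H : FinHypergraph) :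
    HG.zeta t (HG.proj K a (HG.of K H)) = if H.verts.card = a then t ^ H.rank else 0 := by
  rw [HG.proj, HG.of, Finsupp.linearCombination_single, one_smul]
  change HG.zeta t (if H.verts.card = a then _ else _) = _
  split_ifs
  · rw [HG.zeta, Finsupp.linearCombination_single, one_smul]
    rfl
  · exact map_zero _

theorem counit_of {K : Type*} [Field K] (H : FinHypergraph) :
    HG.counit K (HG.of K H) = if H.verts.card = 0 then 1 else 0 := by
  rw [HG.counit, HG.of, Finsupp.linearCombination_single, one_smul]
  rfl

theorem zetaComp_of {K : Type*} [Field K] (t : K) {α : List ℕ} (hα : ∀ a ∈ α, 0 < a)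
    (H : FinHypergraph) :
    HG.zetaComp (HG.zeta t) α (HG.of K H) =
      ∑ L ∈ setCompositions H.verts with L.map Finset.card = α, t ^ minorRank H L := by
  rw [Finset.sum_filter]
  induction α generalizing H with
  | nil =>
    rw [HG.zetaComp, counit_of]
    simp only [List.map_eq_nil_iff, Finset.card_eq_zero]
    split_ifs with h
    · rw [h, setCompositions_empty, Finset.sum_singleton, if_pos rfl, minorRank, pow_zero]
    · refine (Finset.sum_eq_zero fun L hL => if_neg ?_).symm
      rintro rfl
      exact h (nil_mem_setCompositions.1 hL)
  | cons a α ih =>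
    have ha : 0 < a := hα a List.mem_cons_self
    have step : ∀ S ∈ H.verts.powerset,
        (LinearMap.mul' K K) (TensorProduct.map (HG.zeta t ∘ₗ HG.proj K a)
          (HG.zetaComp (HG.zeta t) α) (HG.of K (H.restrict S) ⊗ₜ[K] HG.of K (H.contract S))) =
        ∑ L ∈ setCompositions (H.verts \ S),
          if (S :: L).map Finset.card = a :: α then t ^ minorRank H (S :: L) else 0 := by
      intro S hS
      have hc : (H.restrict S).verts.card = S.card :=
        congrArg _ (Finset.inter_eq_right.2 (Finset.mem_powerset.1 hS))
      rw [TensorProduct.map_tmul, LinearMap.mul'_apply, LinearMap.comp_apply, zeta_proj_of, hc,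
        ih (fun b hb => hα b (List.mem_cons_of_mem _ hb)), Finset.mul_sum]
      refine Finset.sum_congr rfl fun L _ => ?_
      simp only [List.map_cons, List.cons.injEq, minorRank, pow_add, ite_and, mul_ite, ite_mul,
        zero_mul, mul_zero]
      split_ifs <;> rfl
    rw [HG.zetaComp, LinearMap.comp_apply, LinearMap.comp_apply, comul_of, map_sum, map_sum,
      Finset.sum_congr rfl step]
    rcases H.verts.eq_empty_or_nonempty with h | h
    · rw [h, setCompositions_empty]
      simp [ha.ne]
    · rw [sum_setCompositions h, ← Finset.sum_erase_add _ _ (Finset.empty_mem_powerset H.verts)]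
      refine add_eq_left.2 (Finset.sum_eq_zero fun L _ => if_neg ?_)
      simp [ha.ne]

/-- The specialization of `Ψ_t([H])` at `-1` as a signed sum over ordered set partitions. -/
theorem eval_neg_one_ps_Psi_of {K : Type*} [Field K] [CharZero K] (t : K) (H : FinHypergraph) :
    (QSym.ps (Psi t (HG.of K H))).eval (-1) =
      ∑ L ∈ setCompositions H.verts, t ^ minorRank H L * (-1) ^ L.length := by
  have hPsi : Psi t (HG.of K H) = ∑ α : Composition H.verts.card,
      HG.zetaComp (HG.zeta t) α.blocks (HG.of K H) • QSym.M K α := by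
    rw [Psi]
    conv_lhs => rw [HG.of, Finsupp.linearCombination_single, one_smul]
    rfl
  have hterm : ∀ α : Composition H.verts.card,
      HG.zetaComp (HG.zeta t) α.blocks (HG.of K H) * (-1) ^ α.length =
      ∑ L ∈ setCompositions H.verts, if L.map Finset.card = α.blocks then
        t ^ minorRank H L * (-1) ^ L.length else 0 := by
    intro α
    rw [zetaComp_of t (fun a ha => α.blocks_pos ha), Finset.sum_filter, Finset.sum_mul]
    refine Finset.sum_congr rfl fun L _ => ?_
    split_ifs with h
    · rw [Composition.length, ← h, List.length_map]
    · exact zero_mul _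
  rw [hPsi, eval_neg_one_ps_sum_smul_M, Finset.sum_congr rfl fun α _ => hterm α, Finset.sum_comm]
  refine Finset.sum_congr rfl fun L hL => ?_
  let β : Composition H.verts.card := ⟨L.map Finset.card, fun {a} ha => by
    obtain ⟨S, hS, rfl⟩ := List.mem_map.1 ha
    exact (nonempty_of_mem_setCompositions hL S hS).card_pos, sum_card_of_mem_setCompositions hL⟩
  rw [Finset.sum_eq_single β]
  · exact if_pos rfl
  · intro α _ hα
    exact if_neg fun h => hα (Composition.ext h.symm)
  · exact fun h => absurd (Finset.mem_univ β) h

/-! ### Connected components -/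

theorem card_image_le_of_imp {ι X Y : Type*} [DecidableEq X] [DecidableEq Y] {S : Finset ι}
    {f : ι → X} {g : ι → Y} (h : ∀ i ∈ S, ∀ j ∈ S, f i = f j → g i = g j) :
    (S.image g).card ≤ (S.image f).card := by
  have h1 : (S.image g) = (S.image fun i => (f i, g i)).image Prod.snd := by
    rw [Finset.image_image]
    rfl
  have h2 : (S.image f) = (S.image fun i => (f i, g i)).image Prod.fst := by
    rw [Finset.image_image]
    rfl
  rw [h1, h2, Finset.card_image_of_injOn (f := Prod.fst)]
  · exact Finset.card_image_le
  · intro x hx y hy hxy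
    obtain ⟨i, hi, rfl⟩ := Finset.mem_image.1 (Finset.mem_coe.1 hx)
    obtain ⟨j, hj, rfl⟩ := Finset.mem_image.1 (Finset.mem_coe.1 hy)
    exact Prod.ext hxy (h i hi j hj hxy)

namespace FinHypergraph

/-- Two vertices are adjacent if they lie in a common hyperedge. -/
def Adj (H : FinHypergraph) (i j : ℕ) : Prop := ∃ e ∈ H.edges, i ∈ e ∧ j ∈ e

/-- The connected component of a vertex. The relation is taken on all natural numbers rather than
on the vertices; this only adds a singleton class for each number that is not a vertex. -/
def component (H : FinHypergraph) (i : ℕ) : Quot H.Adj := Quot.mk H.Adj i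

open Classical in
theorem numComponents_eq_card_image (H : FinHypergraph) :
    H.numComponents = (H.verts.image H.component).card := by
  let r : H.verts → H.verts → Prop := fun i j => ∃ e ∈ H.edges, (i : ℕ) ∈ e ∧ (j : ℕ) ∈ e
  have key : ∀ i j, Relation.EqvGen H.Adj i j → (i ∈ H.verts ↔ j ∈ H.verts) ∧
      ∀ (hi : i ∈ H.verts) (hj : j ∈ H.verts), Quot.mk r ⟨i, hi⟩ = Quot.mk r ⟨j, hj⟩ := by
    intro i j h
    induction h with
    | rel i j h =>
      obtain ⟨e, he, hi, hj⟩ := h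
      exact ⟨⟨fun _ => H.subset_verts e he hj, fun _ => H.subset_verts e he hi⟩,
        fun _ _ => Quot.sound ⟨e, he, hi, hj⟩⟩
    | refl i => exact ⟨Iff.rfl, fun _ _ => rfl⟩
    | symm i j _ ih => exact ⟨ih.1.symm, fun hi hj => (ih.2 hj hi).symm⟩
    | trans i j k _ _ ih1 ih2 =>
      exact ⟨ih1.1.trans ih2.1, fun hi hk => (ih1.2 hi (ih1.1.1 hi)).trans (ih2.2 _ hk)⟩
  let F : Quot r → H.verts.image H.component := Quot.lift
    (fun i => ⟨H.component i, Finset.mem_image_of_mem _ i.2⟩)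
    fun i j h => Subtype.ext (Quot.sound h)
  have hF : Function.Bijective F := by
    constructor
    · rintro ⟨i⟩ ⟨j⟩ h
      exact (key i j (Quot.eqvGen_exact (congrArg Subtype.val h))).2 i.2 j.2
    · rintro ⟨x, hx⟩
      obtain ⟨i, hi, rfl⟩ := Finset.mem_image.1 hx
      exact ⟨Quot.mk r ⟨i, hi⟩, rfl⟩
  rw [numComponents, Nat.card_congr (Equiv.ofBijective F hF), Nat.card_eq_fintype_card,
    Fintype.card_coe]

theorem rank_add_numComponents (H : FinHypergraph) :
    H.rank + H.numComponents = H.verts.card := by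
  classical
  refine Nat.sub_add_cancel ?_
  rw [numComponents_eq_card_image]
  exact Finset.card_image_le

theorem component_eq_iff_of_edges_union {H H₁ H₂ : FinHypergraph}
    (hE : H.edges = H₁.edges ∪ H₂.edges) (hd : Disjoint H₁.verts H₂.verts) {i : ℕ}
    (hi : i ∈ H₁.verts) (j : ℕ) :
    H.component i = H.component j ↔ j ∈ H₁.verts ∧ H₁.component i = H₁.component j := by
  have key : ∀ i j, Relation.EqvGen H.Adj i j → (i ∈ H₁.verts ↔ j ∈ H₁.verts) ∧
      (i ∈ H₁.verts → H₁.component i = H₁.component j) := by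
    intro i j h
    induction h with
    | rel i j h =>
      obtain ⟨e, he, hi, hj⟩ := h
      rw [hE, Finset.mem_union] at he
      rcases he with he | he
      · have hi' := H₁.subset_verts e he hi
        have hj' := H₁.subset_verts e he hj
        exact ⟨iff_of_true hi' hj', fun _ => Quot.sound ⟨e, he, hi, hj⟩⟩
      · have hi' := Finset.disjoint_right.1 hd (H₂.subset_verts e he hi)
        have hj' := Finset.disjoint_right.1 hd (H₂.subset_verts e he hj)
        exact ⟨iff_of_false hi' hj', fun h => absurd h hi'⟩
    | refl i => exact ⟨Iff.rfl, fun _ => rfl⟩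
    | symm i j _ ih => exact ⟨ih.1.symm, fun hj => (ih.2 (ih.1.2 hj)).symm⟩
    | trans i j k _ _ ih1 ih2 =>
      exact ⟨ih1.1.trans ih2.1, fun hi => (ih1.2 hi).trans (ih2.2 (ih1.1.1 hi))⟩
  constructor
  · intro h
    obtain ⟨h1, h2⟩ := key i j (Quot.eqvGen_exact h)
    exact ⟨h1.1 hi, h2 hi⟩
  · rintro ⟨-, h⟩
    have h' := Quot.eqvGen_exact h
    refine Quot.eqvGen_sound (h'.mono fun a b => ?_)
    rintro ⟨e, he, ha, hb⟩
    exact ⟨e, hE ▸ Finset.mem_union_left _ he, ha, hb⟩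

open Classical in
theorem rank_of_disjoint_union {H H₁ H₂ : FinHypergraph} (hV : H.verts = H₁.verts ∪ H₂.verts)
    (hE : H.edges = H₁.edges ∪ H₂.edges) (hd : Disjoint H₁.verts H₂.verts) :
    H.rank = H₁.rank + H₂.rank := by
  have h1 := fun i => component_eq_iff_of_edges_union (i := i) hE hd
  have h2 := fun i => component_eq_iff_of_edges_union (i := i)
    (hE.trans (Finset.union_comm _ _)) hd.symm
  have hc1 : (H₁.verts.image H.component).card = H₁.numComponents := by
    rw [numComponents_eq_card_image]
    exact le_antisymm (card_image_le_of_imp fun i hi j hj h => (h1 i hi j).2 ⟨hj, h⟩)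
      (card_image_le_of_imp fun i hi j _ h => ((h1 i hi j).1 h).2)
  have hc2 : (H₂.verts.image H.component).card = H₂.numComponents := by
    rw [numComponents_eq_card_image]
    exact le_antisymm (card_image_le_of_imp fun i hi j hj h => (h2 i hi j).2 ⟨hj, h⟩)
      (card_image_le_of_imp fun i hi j _ h => ((h2 i hi j).1 h).2)
  have hdisj : Disjoint (H₁.verts.image H.component) (H₂.verts.image H.component) := by
    refine Finset.disjoint_left.2 fun x hx hx' => ?_
    obtain ⟨i, hi, rfl⟩ := Finset.mem_image.1 hx
    obtain ⟨j, hj, hij⟩ := Finset.mem_image.1 hx'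
    exact Finset.disjoint_left.1 hd ((h1 i hi j).1 hij.symm).1 hj
  have hc : H.numComponents = H₁.numComponents + H₂.numComponents := by
    rw [numComponents_eq_card_image H, hV, Finset.image_union, Finset.card_union_of_disjoint hdisj,
      hc1, hc2]
  have hcard : H.verts.card = H₁.verts.card + H₂.verts.card := by
    rw [hV, Finset.card_union_of_disjoint hd]
  have e := H.rank_add_numComponents
  have e1 := H₁.rank_add_numComponents
  have e2 := H₂.rank_add_numComponents
  omega

end FinHypergraph

/-! ### The hypergraph of a face -/

/-- The set of the elements of `e` at which `w` is maximal on `e`. -/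
def argmaxOn {β : Type*} [LinearOrder β] (w : ℕ → β) (e : Finset ℕ) : Finset ℕ :=
  e.filter fun i => ∀ j ∈ e, w j ≤ w i

section argmaxOn

variable {β : Type*} [LinearOrder β]

theorem mem_argmaxOn {w : ℕ → β} {e : Finset ℕ} {i : ℕ} :
    i ∈ argmaxOn w e ↔ i ∈ e ∧ ∀ j ∈ e, w j ≤ w i :=
  Finset.mem_filter

theorem argmaxOn_subset (w : ℕ → β) (e : Finset ℕ) : argmaxOn w e ⊆ e :=
  Finset.filter_subset _ _

theorem argmaxOn_nonempty (w : ℕ → β) {e : Finset ℕ} (he : e.Nonempty) :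
    (argmaxOn w e).Nonempty := by
  obtain ⟨i, hi, h⟩ := e.exists_max_image w he
  exact ⟨i, mem_argmaxOn.2 ⟨hi, h⟩⟩

theorem argmaxOn_congr {γ : Type*} [LinearOrder γ] {w : ℕ → β} {w' : ℕ → γ} {e : Finset ℕ}
    (h : ∀ i ∈ e, ∀ j ∈ e, w i ≤ w j ↔ w' i ≤ w' j) : argmaxOn w e = argmaxOn w' e := by
  ext i
  rw [mem_argmaxOn, mem_argmaxOn]
  exact and_congr_right fun hi => forall₂_congr fun j hj => h j hj i hi

end argmaxOn

namespace FinHypergraph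

/-- The hypergraph with hyperedges `argmaxOn w e` for `e ∈ H`. The face of the polytope of `H` in
direction `w` is the polytope of this hypergraph, up to multiplicities of the hyperedges. -/
def faceHypergraph {β : Type*} [LinearOrder β] (H : FinHypergraph) (w : ℕ → β) : FinHypergraph where
  verts := H.verts
  edges := H.edges.image (argmaxOn w)
  subset_verts := by
    intro u hu
    obtain ⟨e, he, rfl⟩ := Finset.mem_image.1 hu
    exact (argmaxOn_subset w e).trans (H.subset_verts e he)
  edge_nonempty := by
    intro u hu
    obtain ⟨e, he, rfl⟩ := Finset.mem_image.1 hu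
    exact argmaxOn_nonempty w (H.edge_nonempty e he)
  singleton_mem := by
    intro v hv
    refine Finset.mem_image.2 ⟨{v}, H.singleton_mem v hv, ?_⟩
    exact (argmaxOn_nonempty w (Finset.singleton_nonempty v)).subset_singleton_iff.1
      (argmaxOn_subset w {v})

theorem argmaxOn_level_cons_of_subset {S e : Finset ℕ} (L : List (Finset ℕ)) (he : e ⊆ S) :
    argmaxOn (level (S :: L)) e = e := by
  refine subset_antisymm (argmaxOn_subset _ _) fun i hi => mem_argmaxOn.2 ⟨hi, fun j hj => ?_⟩
  simp [level, he hi, he hj]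

theorem argmaxOn_level_cons_of_not_subset {S e : Finset ℕ} (L : List (Finset ℕ)) (he : ¬ e ⊆ S) :
    argmaxOn (level (S :: L)) e = argmaxOn (level L) (e \ S) := by
  obtain ⟨a, ha, haS⟩ := Finset.not_subset.1 he
  ext i
  rw [mem_argmaxOn, mem_argmaxOn, Finset.mem_sdiff]
  constructor
  · rintro ⟨hi, h⟩
    have hiS : i ∉ S := fun hiS => by simpa [level, hiS, haS] using h a ha
    refine ⟨⟨hi, hiS⟩, fun j hj => ?_⟩
    rw [Finset.mem_sdiff] at hj
    simpa [level, hiS, hj.2] using h j hj.1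
  · rintro ⟨⟨hi, hiS⟩, h⟩
    refine ⟨hi, fun j hj => ?_⟩
    by_cases hjS : j ∈ S
    · simp [level, hjS]
    · simpa [level, hiS, hjS] using h j (Finset.mem_sdiff.2 ⟨hj, hjS⟩)

theorem edges_faceHypergraph_level_cons (H : FinHypergraph) (S : Finset ℕ) (L : List (Finset ℕ)) :
    (H.faceHypergraph (level (S :: L))).edges =
      (H.restrict S).edges ∪ ((H.contract S).faceHypergraph (level L)).edges := by
  ext u
  simp only [faceHypergraph, restrict, contract, Finset.mem_union, Finset.mem_image,
    Finset.mem_filter, Finset.mem_erase]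
  constructor
  · rintro ⟨e, he, rfl⟩
    by_cases heS : e ⊆ S
    · rw [argmaxOn_level_cons_of_subset L heS]
      exact Or.inl ⟨he, heS⟩
    · rw [argmaxOn_level_cons_of_not_subset L heS]
      exact Or.inr ⟨e \ S, ⟨fun h => heS (Finset.sdiff_eq_empty_iff_subset.1 h), e, he, rfl⟩, rfl⟩
  · rintro (⟨he, heS⟩ | ⟨_, ⟨hne, e, he, rfl⟩, rfl⟩)
    · exact ⟨u, he, argmaxOn_level_cons_of_subset L heS⟩
    · exact ⟨e, he, argmaxOn_level_cons_of_not_subset L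
        fun h => hne (Finset.sdiff_eq_empty_iff_subset.2 h)⟩

/-- The face hypergraph is the disjoint union of the successive minors. -/
theorem minorRank_eq_rank_faceHypergraph {H : FinHypergraph} {L : List (Finset ℕ)}
    (hL : L ∈ setCompositions H.verts) : minorRank H L = (H.faceHypergraph (level L)).rank := by
  induction L generalizing H with
  | nil =>
    have h : (H.faceHypergraph (level [])).verts = ∅ := nil_mem_setCompositions.1 hL
    rw [minorRank, rank, h, Finset.card_empty, Nat.zero_sub]
  | cons S L ih =>
    obtain ⟨-, hS, hL'⟩ := mem_setCompositions_cons.1 hL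
    rw [minorRank, ih hL']
    refine (rank_of_disjoint_union ?_ (edges_faceHypergraph_level_cons H S L) ?_).symm
    · change H.verts = (H.verts ∩ S) ∪ (H.verts \ S)
      rw [Finset.union_comm, Finset.sdiff_union_inter]
    · change Disjoint (H.verts ∩ S) (H.verts \ S)
      exact Finset.disjoint_sdiff.mono_left Finset.inter_subset_right

end FinHypergraph

/-! ### Faces and directions of Minkowski sums -/

theorem mem_toExposed {E : Type*} [AddCommGroup E] [Module ℝ E] [TopologicalSpace E]
    {l : StrongDual ℝ E} {A : Set E} {x : E} :
    x ∈ l.toExposed A ↔ x ∈ A ∧ ∀ y ∈ A, l y ≤ l x :=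
  Iff.rfl

/-- A linear functional is maximal at a point of a Minkowski sum only if it is maximal at each
summand of that point. -/
theorem mem_toExposed_of_sum_mem_toExposed {ι E : Type*} [AddCommGroup E] [Module ℝ E]
    [TopologicalSpace E] (l : StrongDual ℝ E) {s : Finset ι} {Q : ι → Set E} {g : ι → E}
    (hg : ∀ i ∈ s, g i ∈ Q i) (h : ∑ i ∈ s, g i ∈ l.toExposed (∑ i ∈ s, Q i)) :
    ∀ i ∈ s, g i ∈ l.toExposed (Q i) := by
  classical
  intro i hi
  refine mem_toExposed.2 ⟨hg i hi, fun y hy => ?_⟩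
  have h1 := (mem_toExposed.1 h).2 (∑ j ∈ s, Function.update g i y j)
    (Set.finsetSum_mem_finsetSum _ _ _ fun j hj => ?_)
  · rw [map_sum, map_sum, ← Finset.add_sum_erase s _ hi, ← Finset.add_sum_erase s _ hi,
      Function.update_self, Finset.sum_congr rfl fun j hj => by
        rw [Function.update_of_ne (Finset.ne_of_mem_erase hj)]] at h1
    exact le_of_add_le_add_right h1
  · rcases eq_or_ne j i with rfl | hji
    · rwa [Function.update_self]
    · rw [Function.update_of_ne hji]
      exact hg j hj

theorem toExposed_sum {ι E : Type*} [AddCommGroup E] [Module ℝ E] [TopologicalSpace E]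
    (l : StrongDual ℝ E) (s : Finset ι) (Q : ι → Set E) :
    l.toExposed (∑ i ∈ s, Q i) = ∑ i ∈ s, l.toExposed (Q i) := by
  ext x
  constructor
  · intro hx
    obtain ⟨g, hg, rfl⟩ := (Set.mem_finsetSum _ _ _).1 hx.1
    exact Set.finsetSum_mem_finsetSum _ _ _
      (mem_toExposed_of_sum_mem_toExposed l (fun i hi => hg hi) hx)
  · intro hx
    obtain ⟨g, hg, rfl⟩ := (Set.mem_finsetSum _ _ _).1 hx
    refine mem_toExposed.2 ⟨Set.finsetSum_mem_finsetSum _ _ _ fun i hi => (hg hi).1, ?_⟩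
    intro y hy
    obtain ⟨f, hf, rfl⟩ := (Set.mem_finsetSum _ _ _).1 hy
    rw [map_sum, map_sum]
    exact Finset.sum_le_sum fun i hi => (hg hi).2 _ (hf hi)

theorem vectorSpan_add {E : Type*} [AddCommGroup E] [Module ℝ E] {A B : Set E}
    (hA : A.Nonempty) (hB : B.Nonempty) :
    vectorSpan ℝ (A + B) = vectorSpan ℝ A ⊔ vectorSpan ℝ B := by
  apply le_antisymm
  · rw [vectorSpan_def, Submodule.span_le]
    rintro _ ⟨_, ⟨a, ha, b, hb, rfl⟩, _, ⟨a', ha', b', hb', rfl⟩, rfl⟩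
    have : (a + b) -ᵥ (a' + b') = (a -ᵥ a') + (b -ᵥ b') := by
      simp only [vsub_eq_sub]
      abel
    change (a + b) -ᵥ (a' + b') ∈ _
    rw [this]
    exact Submodule.add_mem_sup (vsub_mem_vectorSpan ℝ ha ha') (vsub_mem_vectorSpan ℝ hb hb')
  · refine sup_le ?_ ?_
    · rw [vectorSpan_def, Submodule.span_le]
      rintro _ ⟨a, ha, a', ha', rfl⟩
      obtain ⟨b, hb⟩ := hB
      have := vsub_mem_vectorSpan ℝ (Set.add_mem_add ha hb) (Set.add_mem_add ha' hb)
      rwa [vsub_eq_sub, add_sub_add_right_eq_sub] at this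
    · rw [vectorSpan_def, Submodule.span_le]
      rintro _ ⟨b, hb, b', hb', rfl⟩
      obtain ⟨a, ha⟩ := hA
      have := vsub_mem_vectorSpan ℝ (Set.add_mem_add ha hb) (Set.add_mem_add ha hb')
      rwa [vsub_eq_sub, add_sub_add_left_eq_sub] at this

theorem nonempty_finsetSum {ι E : Type*} [AddCommMonoid E] {s : Finset ι} {Q : ι → Set E}
    (h : ∀ i ∈ s, (Q i).Nonempty) : (∑ i ∈ s, Q i).Nonempty := by
  choose! g hg using h
  exact ⟨∑ i ∈ s, g i, Set.finsetSum_mem_finsetSum _ _ _ hg⟩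

theorem vectorSpan_finsetSum {ι E : Type*} [AddCommGroup E] [Module ℝ E] {s : Finset ι}
    {Q : ι → Set E} (h : ∀ i ∈ s, (Q i).Nonempty) :
    vectorSpan ℝ (∑ i ∈ s, Q i) = ⨆ i ∈ s, vectorSpan ℝ (Q i) := by
  classical
  induction s using Finset.induction_on with
  | empty => simp [← Set.singleton_zero]
  | insert i s hi ih =>
    have h' : ∀ j ∈ s, (Q j).Nonempty := fun j hj => h j (Finset.mem_insert_of_mem hj)
    rw [Finset.sum_insert hi, vectorSpan_add (h i (Finset.mem_insert_self i s))
      (nonempty_finsetSum h'), ih h', Finset.iSup_insert]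

/-! ### Faces of the hypergraphic polytope -/

namespace FinHypergraph

variable {H : FinHypergraph}

theorem single_mem_simplex {e : Finset ℕ} {i : H.verts} (hi : (i : ℕ) ∈ e) :
    (Pi.single i 1 : H.verts → ℝ) ∈ H.simplex e :=
  subset_convexHull ℝ _ ⟨i, hi, rfl⟩

theorem simplex_nonempty {e : Finset ℕ} (he : e ⊆ H.verts) (hne : e.Nonempty) :
    (H.simplex e).Nonempty := by
  obtain ⟨i, hi⟩ := hne
  exact ⟨_, single_mem_simplex (i := ⟨i, he hi⟩) hi⟩

theorem mem_simplex_iff {e : Finset ℕ} {x : H.verts → ℝ} :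
    x ∈ H.simplex e ↔ (∀ i, 0 ≤ x i) ∧ ∑ i, x i = 1 ∧ ∀ i : H.verts, (i : ℕ) ∉ e → x i = 0 := by
  classical
  constructor
  · intro hx
    have hmem : x ∈ stdSimplex ℝ H.verts := by
      rw [← convexHull_basis_eq_stdSimplex]
      refine convexHull_mono ?_ hx
      rintro _ ⟨i, -, rfl⟩
      refine ⟨i, ?_⟩
      ext j
      simp [Pi.single_apply, eq_comm]
    have hsub : H.simplex e ⊆ {x | ∀ i : H.verts, (i : ℕ) ∉ e → x i = 0} := by
      refine convexHull_min ?_ ?_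
      · rintro _ ⟨i, hi, rfl⟩ j hj
        exact Pi.single_eq_of_ne (fun h => hj (by rw [h]; exact hi)) _
      · intro y hy z hz a b _ _ _ i hi
        simp [hy i hi, hz i hi]
    exact ⟨hmem.1, hmem.2, hsub hx⟩
  · rintro ⟨h1, h2, h3⟩
    have hx : x = ∑ i ∈ Finset.univ.filter (fun i : H.verts => (i : ℕ) ∈ e),
        x i • (Pi.single i 1 : H.verts → ℝ) := by
      rw [Finset.sum_filter_of_ne]
      · exact pi_eq_sum_univ' x
      · intro i _ hi
        by_contra hn
        exact hi (by rw [h3 i hn, zero_smul])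
    rw [hx]
    refine (convex_convexHull ℝ _).sum_mem (fun i _ => h1 i) ?_
      fun i hi => single_mem_simplex (Finset.mem_filter.1 hi).2
    rw [Finset.sum_filter_of_ne, h2]
    intro i _ hi
    by_contra hn
    exact hi (h3 i hn)

theorem dual_apply_eq_sum {w : ℕ → ℝ} {l : StrongDual ℝ (H.verts → ℝ)}
    (hl : ∀ i : H.verts, l (Pi.single i 1) = w i) (x : H.verts → ℝ) : l x = ∑ i, x i * w i := by
  conv_lhs => rw [pi_eq_sum_univ' x, map_sum]
  simp only [map_smul, hl, smul_eq_mul]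

/-- The face of a simplex at which a linear functional is maximal. -/
theorem toExposed_simplex {w : ℕ → ℝ} {l : StrongDual ℝ (H.verts → ℝ)}
    (hl : ∀ i : H.verts, l (Pi.single i 1) = w i) {e : Finset ℕ} (he : e ⊆ H.verts)
    (hne : e.Nonempty) : l.toExposed (H.simplex e) = H.simplex (argmaxOn w e) := by
  obtain ⟨a, ha⟩ := argmaxOn_nonempty w hne
  rw [mem_argmaxOn] at ha
  -- For a point of the simplex, `w a - l x` is a sum of nonnegative terms.
  have key : ∀ x ∈ H.simplex e, w a - l x = ∑ i, x i * (w a - w i) ∧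
      ∀ i, 0 ≤ x i * (w a - w i) := by
    intro x hx
    obtain ⟨h1, h2, h3⟩ := mem_simplex_iff.1 hx
    constructor
    · simp only [mul_sub, Finset.sum_sub_distrib, ← Finset.sum_mul, h2, one_mul,
        dual_apply_eq_sum hl]
    · intro i
      by_cases hi : (i : ℕ) ∈ e
      · exact mul_nonneg (h1 i) (sub_nonneg.2 (ha.2 i hi))
      · rw [h3 i hi, zero_mul]
  have hmax : ∀ x ∈ H.simplex e, l x ≤ w a := by
    intro x hx
    rw [← sub_nonneg, (key x hx).1]
    exact Finset.sum_nonneg fun i _ => (key x hx).2 i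
  ext x
  rw [mem_toExposed]
  constructor
  · rintro ⟨hx, hx'⟩
    obtain ⟨h1, h2, h3⟩ := mem_simplex_iff.1 hx
    refine mem_simplex_iff.2 ⟨h1, h2, fun i hi => ?_⟩
    by_cases hie : (i : ℕ) ∈ e
    · have hlx : w a - l x = 0 := by
        have := hx' _ (single_mem_simplex (i := ⟨a, he ha.1⟩) ha.1)
        rw [hl] at this
        exact sub_eq_zero.2 (le_antisymm this (hmax x hx))
      rw [(key x hx).1, Finset.sum_eq_zero_iff_of_nonneg fun i _ => (key x hx).2 i] at hlx
      refine (mul_eq_zero.1 (hlx i (Finset.mem_univ i))).resolve_right fun h => hi ?_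
      exact mem_argmaxOn.2 ⟨hie, fun j hj => sub_eq_zero.1 h ▸ ha.2 j hj⟩
    · exact h3 i hie
  · intro hx
    obtain ⟨h1, h2, h3⟩ := mem_simplex_iff.1 hx
    have hx' : x ∈ H.simplex e :=
      mem_simplex_iff.2 ⟨h1, h2, fun i hi => h3 i fun h => hi (argmaxOn_subset w e h)⟩
    have hlx : w a - l x = 0 := by
      rw [(key x hx').1]
      refine Finset.sum_eq_zero fun i _ => ?_
      by_cases hi : (i : ℕ) ∈ argmaxOn w e
      · rw [mem_argmaxOn] at hi
        rw [le_antisymm (hi.2 a ha.1) (ha.2 i hi.1), sub_self, mul_zero]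
      · rw [h3 i hi, zero_mul]
    exact ⟨hx', fun y hy => sub_eq_zero.1 hlx ▸ hmax y hy⟩

/-- The face of the polytope of `H` in direction `w`. -/
def face {β : Type*} [LinearOrder β] (H : FinHypergraph) (w : ℕ → β) : Set (H.verts → ℝ) :=
  ∑ e ∈ H.edges, H.simplex (argmaxOn w e)

theorem face_congr {β γ : Type*} [LinearOrder β] [LinearOrder γ] {w : ℕ → β} {w' : ℕ → γ}
    (h : ∀ e ∈ H.edges, argmaxOn w e = argmaxOn w' e) : H.face w = H.face w' :=
  Finset.sum_congr rfl fun e he => by rw [h e he]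

theorem toExposed_polytope {w : ℕ → ℝ} {l : StrongDual ℝ (H.verts → ℝ)}
    (hl : ∀ i : H.verts, l (Pi.single i 1) = w i) : l.toExposed H.polytope = H.face w := by
  rw [polytope, toExposed_sum]
  exact Finset.sum_congr rfl fun e he =>
    toExposed_simplex hl (H.subset_verts e he) (H.edge_nonempty e he)

theorem exists_dual_eq (H : FinHypergraph) (w : ℕ → ℝ) :
    ∃ l : StrongDual ℝ (H.verts → ℝ), ∀ i : H.verts, l (Pi.single i 1) = w i := by
  classical
  refine ⟨∑ i : H.verts, w i • ContinuousLinearMap.proj i, fun i => ?_⟩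
  simp [Pi.single_apply]

theorem argmaxOn_simplex_nonempty {β : Type*} [LinearOrder β] (w : ℕ → β) {e : Finset ℕ}
    (he : e ∈ H.edges) : (H.simplex (argmaxOn w e)).Nonempty :=
  simplex_nonempty ((argmaxOn_subset w e).trans (H.subset_verts e he))
    (argmaxOn_nonempty w (H.edge_nonempty e he))

theorem face_nonempty {β : Type*} [LinearOrder β] (H : FinHypergraph) (w : ℕ → β) :
    (H.face w).Nonempty :=
  nonempty_finsetSum fun _ he => argmaxOn_simplex_nonempty w he

/-- The nonempty faces of the polytope are the faces in the directions given by ordered set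
partitions. -/
theorem nonempty_isExposed_polytope_iff {G : Set (H.verts → ℝ)} :
    G.Nonempty ∧ IsExposed ℝ H.polytope G ↔
      ∃ L ∈ setCompositions H.verts, H.face (level L) = G := by
  classical
  constructor
  · rintro ⟨hG, hexp⟩
    obtain ⟨l, rfl⟩ := hexp hG
    let w : ℕ → ℝ := fun i => if h : i ∈ H.verts then l (Pi.single ⟨i, h⟩ 1) else 0
    have hl : ∀ i : H.verts, l (Pi.single i 1) = w i := fun i => by simp [w]
    obtain ⟨L, hL, hw⟩ := exists_mem_setCompositions_level_le_iff H.verts w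
    refine ⟨L, hL, Eq.trans ?_ (toExposed_polytope hl).symm⟩
    refine face_congr fun e he => argmaxOn_congr fun i hi j hj => ?_
    exact hw i (H.subset_verts e he hi) j (H.subset_verts e he hj)
  · rintro ⟨L, -, rfl⟩
    refine ⟨H.face_nonempty _, ?_⟩
    obtain ⟨l, hl⟩ := H.exists_dual_eq fun i => (level L i : ℝ)
    have hf : H.face (level L) = l.toExposed H.polytope := by
      rw [toExposed_polytope (w := fun i => (level L i : ℝ)) hl]
      exact face_congr fun e _ => argmaxOn_congr fun i _ j _ => Nat.cast_le.symm
    rw [hf]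
    exact ContinuousLinearMap.toExposed.isExposed

theorem argmaxOn_subset_of_face_eq {w w' : ℕ → ℝ} (h : H.face w = H.face w') :
    ∀ e ∈ H.edges, argmaxOn w e ⊆ argmaxOn w' e := by
  classical
  intro e he i hi
  have hiV : i ∈ H.verts := H.subset_verts e he (argmaxOn_subset w e hi)
  obtain ⟨l, hl⟩ := H.exists_dual_eq w'
  choose! g hg using fun u (hu : u ∈ H.edges) => argmaxOn_simplex_nonempty w hu
  let g' : Finset ℕ → H.verts → ℝ := Function.update g e (Pi.single ⟨i, hiV⟩ 1)
  have hg' : ∀ u ∈ H.edges, g' u ∈ H.simplex (argmaxOn w u) := by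
    intro u hu
    rcases eq_or_ne u e with rfl | hue
    · simp only [g', Function.update_self]
      exact single_mem_simplex hi
    · simp only [g', Function.update_of_ne hue]
      exact hg u hu
  have hsum : ∑ u ∈ H.edges, g' u ∈ l.toExposed (∑ u ∈ H.edges, H.simplex u) := by
    change _ ∈ l.toExposed H.polytope
    rw [toExposed_polytope hl, ← h]
    exact Set.finsetSum_mem_finsetSum _ _ _ hg'
  have hmem := mem_toExposed_of_sum_mem_toExposed l (fun u hu => ?_) hsum e he
  · rw [toExposed_simplex hl (H.subset_verts e he) (H.edge_nonempty e he)] at hmem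
    by_contra hn
    have h0 := (mem_simplex_iff.1 hmem).2.2 ⟨i, hiV⟩ hn
    simp [g'] at h0
  · obtain ⟨h1, h2, h3⟩ := mem_simplex_iff.1 (hg' u hu)
    exact mem_simplex_iff.2 ⟨h1, h2, fun j hj => h3 j fun hj' => hj (argmaxOn_subset w u hj')⟩

theorem face_level_eq_iff {L L' : List (Finset ℕ)} :
    H.face (level L) = H.face (level L') ↔
      ∀ e ∈ H.edges, argmaxOn (level L) e = argmaxOn (level L') e := by
  refine ⟨fun h e he => ?_, face_congr⟩
  have hcast : ∀ (M : List (Finset ℕ)) (u : Finset ℕ),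
      argmaxOn (level M) u = argmaxOn (fun i => (level M i : ℝ)) u :=
    fun M u => argmaxOn_congr fun i _ j _ => Nat.cast_le.symm
  rw [face_congr fun u _ => hcast L u, face_congr fun u _ => hcast L' u] at h
  rw [hcast, hcast]
  exact subset_antisymm (argmaxOn_subset_of_face_eq h e he)
    (argmaxOn_subset_of_face_eq h.symm e he)

/-! ### Dimensions of faces -/

theorem vectorSpan_simplex (e : Finset ℕ) :
    vectorSpan ℝ (H.simplex e) = vectorSpan ℝ
      ((fun i : H.verts => (Pi.single i 1 : H.verts → ℝ)) '' {i | (i : ℕ) ∈ e}) := by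
  rw [simplex, ← direction_affineSpan, affineSpan_convexHull, direction_affineSpan]

/-- The dimension of a face is the rank of the corresponding hypergraph: its direction consists of
the vectors whose coordinates add up to zero on each connected component. -/
theorem finrank_vectorSpan_face {β : Type*} [LinearOrder β] (H : FinHypergraph) (w : ℕ → β) :
    Module.finrank ℝ (vectorSpan ℝ (H.face w)) = (H.faceHypergraph w).rank := by
  classical
  let r : H.verts → H.verts → Prop := fun i j =>
    ∃ e ∈ (H.faceHypergraph w).edges, (i : ℕ) ∈ e ∧ (j : ℕ) ∈ e
  have hfin : Fintype (Quot r) := Fintype.ofFinite _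
  let T : (H.verts → ℝ) →ₗ[ℝ] (Quot r → ℝ) :=
    Fintype.linearCombination ℝ fun i => Pi.single (Quot.mk r i) 1
  have hT : ∀ i, T (Pi.single i 1) = Pi.single (Quot.mk r i) 1 := fun i => by
    simp [T, Fintype.linearCombination_apply_single]
  have hW : vectorSpan ℝ (H.face w) = ⨆ e ∈ H.edges, vectorSpan ℝ
      ((fun i : H.verts => (Pi.single i 1 : H.verts → ℝ)) '' {i | (i : ℕ) ∈ argmaxOn w e}) := by
    rw [face, vectorSpan_finsetSum fun e he => argmaxOn_simplex_nonempty w he]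
    simp only [vectorSpan_simplex]
  have hle : vectorSpan ℝ (H.face w) ≤ LinearMap.ker T := by
    rw [hW]
    refine iSup₂_le fun e he => ?_
    rw [vectorSpan_def, Submodule.span_le]
    rintro _ ⟨_, ⟨i, hi, rfl⟩, _, ⟨j, hj, rfl⟩, rfl⟩
    change T (Pi.single i 1 - Pi.single j 1) = 0
    rw [map_sub, hT, hT, Quot.sound (r := r) (a := i) (b := j)
      ⟨_, Finset.mem_image_of_mem _ he, hi, hj⟩, sub_self]
  have hge : LinearMap.ker T ≤ vectorSpan ℝ (H.face w) := by
    -- Modulo the direction of the face, a basis vector depends on its component only, so that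
    -- the quotient map factors through `T`.
    let F : Quot r → (H.verts → ℝ) ⧸ vectorSpan ℝ (H.face w) :=
      Quot.lift (fun i => Submodule.Quotient.mk (Pi.single i 1)) (by
        rintro i j ⟨_, hu, hi, hj⟩
        obtain ⟨e, he, rfl⟩ := Finset.mem_image.1 hu
        refine (Submodule.Quotient.eq _).2 ?_
        rw [hW]
        refine Submodule.mem_iSup_of_mem e (Submodule.mem_iSup_of_mem he ?_)
        exact vsub_mem_vectorSpan ℝ ⟨i, hi, rfl⟩ ⟨j, hj, rfl⟩)
    have hfac : (vectorSpan ℝ (H.face w)).mkQ = Fintype.linearCombination ℝ F ∘ₗ T := by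
      refine LinearMap.pi_ext' fun i => LinearMap.ext_ring ?_
      change Submodule.Quotient.mk (Pi.single i 1) =
        Fintype.linearCombination ℝ F (T (Pi.single i 1))
      rw [hT, Fintype.linearCombination_apply_single, one_smul]
    intro x hx
    rw [← Submodule.ker_mkQ (vectorSpan ℝ (H.face w)), hfac, LinearMap.mem_ker,
      LinearMap.comp_apply, LinearMap.mem_ker.1 hx, map_zero]
  have hsurj : LinearMap.range T = ⊤ := by
    refine LinearMap.range_eq_top.2 fun y => ⟨∑ q, y q • Pi.single q.out 1, ?_⟩
    rw [map_sum]
    simp only [map_smul, hT, Quot.out_eq]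
    exact (pi_eq_sum_univ' y).symm
  have hdim := LinearMap.finrank_range_add_finrank_ker T
  rw [hsurj, finrank_top, Module.finrank_fintype_fun_eq_card, Module.finrank_fintype_fun_eq_card,
    ← le_antisymm hle hge, Fintype.card_coe, ← Nat.card_eq_fintype_card] at hdim
  change _ = H.verts.card - Nat.card (Quot r)
  omega

/-! ### Normal cones -/

/-- The ordered set partitions that define the same face as `w` are the linear order types in the
relative interior of a normal cone: equalities within the hyperedges of the face hypergraph, and
strict inequalities between the rest of a hyperedge and its maximal elements. -/
theorem isCompatible_component_iff {w w' : ℕ → ℕ} :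
    IsCompatible (H.faceHypergraph w').component
      (fun i j => ∃ e ∈ H.edges, i ∈ e ∧ i ∉ argmaxOn w' e ∧ j ∈ argmaxOn w' e) H.verts w ↔
      ∀ e ∈ H.edges, argmaxOn w e = argmaxOn w' e := by
  constructor
  · intro h e he
    have hV := H.subset_verts e he
    have heq : ∀ i ∈ argmaxOn w' e, ∀ j ∈ argmaxOn w' e, w i = w j := fun i hi j hj =>
      (h i (hV (argmaxOn_subset _ _ hi)) j (hV (argmaxOn_subset _ _ hj))).1
        (Quot.sound ⟨_, Finset.mem_image_of_mem _ he, hi, hj⟩)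
    have hlt : ∀ i ∈ e, i ∉ argmaxOn w' e → ∀ j ∈ argmaxOn w' e, w i < w j :=
      fun i hi hn j hj => (h i (hV hi) j (hV (argmaxOn_subset _ _ hj))).2 ⟨e, he, hi, hn, hj⟩
    obtain ⟨a, ha⟩ := argmaxOn_nonempty w' (H.edge_nonempty e he)
    refine subset_antisymm (fun i hi => ?_) fun i hi => ?_
    · by_contra hn
      rw [mem_argmaxOn] at hi
      exact (hlt i hi.1 hn a ha).not_ge (hi.2 a (argmaxOn_subset _ _ ha))
    · refine mem_argmaxOn.2 ⟨argmaxOn_subset _ _ hi, fun j hj => ?_⟩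
      by_cases hj' : j ∈ argmaxOn w' e
      · exact (heq j hj' i hi).le
      · exact (hlt j hj hj' i hi).le
  · rintro h i - j -
    constructor
    · intro hc
      replace hc := Quot.eqvGen_exact hc
      induction hc with
      | rel i j hij =>
        obtain ⟨_, hu, hi, hj⟩ := hij
        obtain ⟨e, he, rfl⟩ := Finset.mem_image.1 hu
        rw [← h e he, mem_argmaxOn] at hi hj
        exact le_antisymm (hj.2 i hi.1) (hi.2 j hj.1)
      | refl i => rfl
      | symm i j _ ih => exact ih.symm
      | trans i j k _ _ ih1 ih2 => exact ih1.trans ih2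
    · rintro ⟨e, he, hi, hn, hj⟩
      rw [← h e he] at hn hj
      rw [mem_argmaxOn] at hj
      by_contra hlt
      exact hn (mem_argmaxOn.2 ⟨hi, fun k hk => (hj.2 k hk).trans (not_lt.1 hlt)⟩)

open Classical in
/-- The Euler characteristic with compact supports of the relative interior of a normal cone,
which is an open cell. -/
theorem sum_face_eq_neg_one_pow (L₀ : List (Finset ℕ)) :
    ∑ L ∈ setCompositions H.verts with H.face (level L) = H.face (level L₀),
      (-1 : ℤ) ^ L.length = (-1) ^ (H.faceHypergraph (level L₀)).numComponents := by
  have h := sum_isCompatible_neg_one_pow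
    ((isCompatible_component_iff (H := H) (w := level L₀) (w' := level L₀)).2 fun _ _ => rfl)
  rw [numComponents_eq_card_image]
  change _ = (-1) ^ (H.verts.image _).card
  rw [← h]
  refine Finset.sum_congr (Finset.filter_congr fun L _ => ?_) fun _ _ => rfl
  rw [face_level_eq_iff, isCompatible_component_iff]

/-! ### The f-polynomial -/

theorem finrank_vectorSpan_face_add_numComponents {β : Type*} [LinearOrder β] (H : FinHypergraph)
    (w : ℕ → β) : Module.finrank ℝ (vectorSpan ℝ (H.face w)) +
      (H.faceHypergraph w).numComponents = H.verts.card := by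
  rw [finrank_vectorSpan_face]
  exact rank_add_numComponents _

open Classical in
/-- The nonempty faces of the polytope of `H`. -/
noncomputable def faces (H : FinHypergraph) : Finset (Set (H.verts → ℝ)) :=
  (setCompositions H.verts).image fun L => H.face (level L)

theorem aeval_fPolynomial_polytope {A : Type*} [CommRing A] [Algebra ℤ A] (x : A)
    (H : FinHypergraph) :
    Polynomial.aeval x (fPolynomial H.polytope) =
      ∑ G ∈ H.faces, x ^ Module.finrank ℝ (vectorSpan ℝ G) := by
  classical
  have hmaps : ∀ G ∈ H.faces, Module.finrank ℝ (vectorSpan ℝ G) ∈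
      Finset.range (Module.finrank ℝ (H.verts → ℝ) + 1) := fun G _ =>
    Finset.mem_range.2 (Nat.lt_succ_of_le (Submodule.finrank_le _))
  rw [fPolynomial, map_sum, ← Finset.sum_fiberwise_of_maps_to hmaps]
  refine Finset.sum_congr rfl fun d _ => ?_
  have hcard : faceNumber H.polytope d =
      (H.faces.filter fun G => Module.finrank ℝ (vectorSpan ℝ G) = d).card := by
    rw [faceNumber, ← Set.ncard_coe_finset]
    congr 1
    ext G
    rw [Set.mem_ofPred_eq, ← and_assoc, nonempty_isExposed_polytope_iff, Finset.mem_coe,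
      Finset.mem_filter, faces, Finset.mem_image]
  rw [Polynomial.aeval_monomial, hcard,
    Finset.sum_congr rfl fun G hG => by rw [(Finset.mem_filter.1 hG).2], Finset.sum_const,
    nsmul_eq_mul, eq_intCast, Int.cast_natCast]

end FinHypergraph

theorem corollary1 {k : Type*} [Field k] [CharZero k] (n : ℕ) (H : FinHypergraph)
    (hn : H.verts.card = n) :
    Polynomial.aeval (RatFunc.X : RatFunc k) (fPolynomial H.polytope) =
      (-1) ^ n * (QSym.ps (Psi (-RatFunc.X : RatFunc k) (HG.of (RatFunc k) H))).eval (-1) := by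
  classical
  have : CharZero (RatFunc k) := charZero_of_injective_algebraMap (algebraMap k _).injective
  subst hn
  rw [FinHypergraph.aeval_fPolynomial_polytope, eval_neg_one_ps_Psi_of,
    ← Finset.sum_fiberwise_of_maps_to (t := H.faces) (g := fun L => H.face (level L))
      fun L hL => Finset.mem_image_of_mem _ hL, Finset.mul_sum]
  -- Compare the contributions of a single face.
  refine Finset.sum_congr rfl fun G hG => ?_
  obtain ⟨L₀, -, rfl⟩ := Finset.mem_image.1 hG
  have hterm : ∀ L ∈ (setCompositions H.verts).filter
      (fun L => H.face (level L) = H.face (level L₀)),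
      (-RatFunc.X : RatFunc k) ^ minorRank H L * (-1) ^ L.length =
      (-RatFunc.X) ^ Module.finrank ℝ (vectorSpan ℝ (H.face (level L₀))) *
        (((-1 : ℤ) ^ L.length : ℤ) : RatFunc k) := by
    intro L hL
    obtain ⟨hL, hf⟩ := Finset.mem_filter.1 hL
    rw [FinHypergraph.minorRank_eq_rank_faceHypergraph hL, ← FinHypergraph.finrank_vectorSpan_face,
      hf]
    push_cast
    rfl
  rw [Finset.sum_congr rfl hterm, ← Finset.mul_sum, ← Int.cast_sum,
    FinHypergraph.sum_face_eq_neg_one_pow,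
    ← FinHypergraph.finrank_vectorSpan_face_add_numComponents H (level L₀), neg_pow, pow_add]
  push_cast
  have hsq : ∀ m : ℕ, ((-1 : RatFunc k) ^ m) * (-1) ^ m = 1 := fun m => by rw [← mul_pow]; simp
  generalize Module.finrank ℝ (vectorSpan ℝ (H.face (level L₀))) = d
  generalize (H.faceHypergraph (level L₀)).numComponents = c
  linear_combination (-(RatFunc.X : RatFunc k) ^ d) * (hsq c + hsq d * ((-1) ^ c * (-1) ^ c))
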